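/- Let $n\ge 2$, $M\ge 1$, and let $\Sigma$ be the switched linear system $x(t+1)=A_{\sigma(t)}x(t)$, $y(t)=C_{\sigma(t)}x(t)$, with $x(t)\in\mathbb R^n$, $y(t)\in\mathbb R^p$ and $\sigma(t)\in\mathcal M=\{1,\dots,M\}$. For $\pmb\sigma\in\mathcal M^T$ and $x\in\mathbb R^n$ let $v$ and $z$ be the stacked first $k$ outputs $(y(0),\dots,y(k-1))$ and last $k$ outputs $(y(T-k),\dots,y(T-1))$ of the trajectory with $x(0)=x$ and switching sequence $\pmb\sigma$. Let $\gamma^o_k$ be the infimum of the $\gamma\ge 0$ for which some symmetric $P\succeq I$ satisfies $$z^\top P z\le\gamma^{2(T-k)}\,v^\top P v \qquad (*)$$ for all $(x,\pmb\sigma)\in\mathbb R^n\times\mathcal M^T$. For a sample $\omega_N=\{(x_0^i,\pmb\sigma^i)\}_{i=1}^N$ and $\bar\lambda\ge 1$ let $\gamma^*_k(\omega_N)$ be the minimal $\gamma\ge0$ for which some symmetric $P$ with $I\preceq P\preceq\bar\lambda I$ satisfies $(*)$ for the $N$ sampled trajectories. The samples are i.i.d., with $x_0^i$ uniform on the unit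 sphere of $\mathbb R^n$ and, independently, the $T$ modes in $\pmb\sigma^i$ i.i.d. uniform on $\mathcal M$; their law is $\mathbb P^N$. Assume that $\Sigma$ is pathwise observable with index at most $k$ (so that for every $\pmb\sigma\in\mathcal M^k$, vanishing of $y(0),\dots,y(k-1)$ forces $x(0)=0$), that $k\le T-1$, and that no $\pmb\sigma\in\mathcal M^T$ is degenerate, i.e. for no $\pmb\sigma$ are there $P\succ0$ and $\gamma\ge0$ with equality in $(*)$ for all $x\in\mathbb R^n$. For $\beta\in(0,1)$ and $\varepsilon\ge0$ let the sample complexity $N_s(\varepsilon,\beta)$ be the least $N$ with $\mathbb P^N\{\omega_N:\gamma^o_k\le(1+\varepsilon)\gamma^*_k(\omega_N)\}\ge1-\beta$ ($\infty$ if there is none). Let $$\mathcal I(x;a,b)=\frac{\int_0^x t^{a-1}(1-t)^{b-1}dt}{\int_0^1 t^{a-1}(1-t)^{b-1}dt},\qquad d=\frac{kp(kp+1)}2,\qquad \phi(\epsilon;d,N)=1-\mathcal I(\epsilon;d,N-d+1)\quad(N\ge d),$$ and let $\mathcal N_\phi(\epsilon,\beta)$ be the least $N\ge d$ with $\phi(\epsilon;d,N)\le\beta$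 ($\infty$ if there is none). Then: (i) There is a constant $c\ge1$, depending only on $\Sigma$ and $k$, such that for all $\beta\in(0,1)$ and $\varepsilon\ge0$ $$N_s(\varepsilon,\beta)\le\mathcal N_\phi\!\left(\frac{\mathcal I\big(1-\frac1{(1+\varepsilon)^{2(T-k)}};\frac{n-1}2,\frac12\big)}{M^T\sqrt{(c\bar\lambda)^{n-1}}},\ \beta\right),$$ and the right-hand side is $O\big(\frac1\beta(\frac1\varepsilon)^{n/2}\big)$: there is a constant $K>0$, independent of $\varepsilon$ and $\beta$, such that for all $\beta\in(0,1)$ and $\varepsilon\in(0,1]$ it is finite and at most $K\frac1\beta(\frac1\varepsilon)^{n/2}$. Consequently the scheme is PAC: for all such $\beta,\varepsilon$ and every $N\ge K\frac1\beta(\frac1\varepsilon)^{n/2}$, $\mathbb P^N\{\omega_N:\gamma^o_k\le(1+\varepsilon)\gamma^*_k(\omega_N)\}\ge1-\beta$. (ii) If the joint spectral radius $\rho(\Sigma)=\lim_{j\to\infty}\max_{\pmb\sigma\in\mathcal M^j}\|A_{\sigma_{j-1}}\cdots A_{\sigma_0}\|^{1/j}$ satisfies $\rho(\Sigma)>1$,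 then for all $\beta\in(0,1)$, $\varepsilon\ge0$ and every integer $N\ge N_s(\varepsilon,\beta)$, $$\mathbb P^N\Big\{\omega_N:\gamma^*_k(\omega_N)<\frac1{1+\varepsilon}\Big\}\le\beta .$$ -/

import Mathlib

open MeasureTheory ProbabilityTheory Filter Topology Matrix

/-- A discrete-time switched linear system `x(t+1) = A_{σ(t)} x(t)`, `y(t) = C_{σ(t)} x(t)` with
state dimension `n`, output dimension `p` and `M` modes. -/
structure SLS (n p M : ℕ) where
  /-- the dynamics matrices -/
  A : Fin M → Matrix (Fin n) (Fin n) ℝ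
  /-- the output matrices -/
  C : Fin M → Matrix (Fin p) (Fin n) ℝ

/-- The unit sphere of the Euclidean space `ℝⁿ`. -/
abbrev UnitSphere (n : ℕ) : Type := Metric.sphere (0 : EuclideanSpace ℝ (Fin n)) 1

/-- One random datum: an initial state on the unit sphere and a switching sequence of length `T`. -/
abbrev Datum (n M T : ℕ) : Type := UnitSphere n × (Fin T → Fin M)

namespace SLS

noncomputable section

variable {n p M : ℕ} (S : SLS n p M)

/-- `S.transition σ t = A_{σ(t-1)} ⋯ A_{σ(0)}`, for `t ≤ T`
(it is only used for such `t`; the product stops at the end of the word). -/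
def transition {T : ℕ} (σ : Fin T → Fin M) : ℕ → Matrix (Fin n) (Fin n) ℝ
  | 0 => 1
  | t + 1 => (if h : t < T then S.A (σ ⟨t, h⟩) else 1) * transition σ t

/-- The output `y(t)`, for `t < T`, from the initial state `x` (only used for such `t`). -/
def output {T : ℕ} (σ : Fin T → Fin M) (x : Fin n → ℝ) (t : ℕ) : Fin p → ℝ :=
  if h : t < T then S.C (σ ⟨t, h⟩) *ᵥ (S.transition σ t *ᵥ x) else 0

/-- The stacked outputs `(y(ℓ), …, y(ℓ+k-1))`, for `ℓ + k ≤ T`. -/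
def window {T : ℕ} (σ : Fin T → Fin M) (x : Fin n → ℝ) (ℓ k : ℕ) : Fin k × Fin p → ℝ :=
  fun ij => S.output σ x (ℓ + ij.1) ij.2

/-- A switching sequence is observable if zero output forces a zero initial state. -/
def Observable {k : ℕ} (σ : Fin k → Fin M) : Prop :=
  ∀ x : Fin n → ℝ, S.window σ x 0 k = 0 → x = 0

/-- The pathwise observability index: the least `k` such that all switching sequences of length
`k` are observable, and `⊤` if there is none. -/
def pathwiseIndex : ℕ∞ :=
  ⨅ (k : ℕ) (_ : ∀ σ : Fin k → Fin M, S.Observable σ), (k : ℕ∞)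

/-- The joint spectral radius `lim_k max_{σ ∈ M^k} ‖A_σ‖^{1/k}` (spectral norm). -/
def jsr : ℝ :=
  limUnder atTop fun k : ℕ =>
    ⨆ σ : Fin k → Fin M,
      ‖Matrix.toEuclideanCLM (𝕜 := ℝ) (S.transition σ k)‖ ^ (1 / (k : ℝ))

/-- A switching sequence of length `T` is degenerate (for the window length `k`). -/
def Degenerate (k : ℕ) {T : ℕ} (σ : Fin T → Fin M) : Prop :=
  ∃ (P : Matrix (Fin k × Fin p) (Fin k × Fin p) ℝ) (γ : ℝ), P.PosDef ∧ 0 ≤ γ ∧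
    ∀ x : Fin n → ℝ,
      S.window σ x (T - k) k ⬝ᵥ (P *ᵥ S.window σ x (T - k) k) =
        γ ^ (2 * (T - k)) * (S.window σ x 0 k ⬝ᵥ (P *ᵥ S.window σ x 0 k))

/-- The Lyapunov inequality `zᵀ P z ≤ γ^{2(T-k)} vᵀ P v` for the trajectory from `x` along `σ`,
where `v` and `z` are the first and the last `k` outputs. -/
def Decrease (k : ℕ) {T : ℕ} (γ : ℝ) (P : Matrix (Fin k × Fin p) (Fin k × Fin p) ℝ)
    (σ : Fin T → Fin M) (x : Fin n → ℝ) : Prop :=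
  S.window σ x (T - k) k ⬝ᵥ (P *ᵥ S.window σ x (T - k) k) ≤
    γ ^ (2 * (T - k)) * (S.window σ x 0 k ⬝ᵥ (P *ᵥ S.window σ x 0 k))

/-- Feasibility of `(γ, P)` in the robust program: all trajectories of length `T`, `P ⪰ I`. -/
def RobustFeasible (k T : ℕ) (γ : ℝ) (P : Matrix (Fin k × Fin p) (Fin k × Fin p) ℝ) : Prop :=
  0 ≤ γ ∧ (P - 1).PosSemidef ∧
    ∀ (σ : Fin T → Fin M) (x : Fin n → ℝ), S.Decrease k γ P σ x

/-- Feasibility of `(γ, P)` in the scenario program: the sampled trajectories, `I ⪯ P ⪯ lam I`. -/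
def ScenarioFeasible (k T : ℕ) (lam : ℝ) {N : ℕ} (ω : Fin N → Datum n M T) (γ : ℝ)
    (P : Matrix (Fin k × Fin p) (Fin k × Fin p) ℝ) : Prop :=
  0 ≤ γ ∧ (P - 1).PosSemidef ∧ (lam • 1 - P).PosSemidef ∧
    ∀ i : Fin N, S.Decrease k γ P (ω i).2 (WithLp.ofLp (ω i).1.1)

/-- The optimal `γ` of the robust program. -/
def gammaRobust (k T : ℕ) : ℝ := sInf {γ : ℝ | ∃ P, S.RobustFeasible k T γ P}

/-- The optimal `γ` of the scenario program, that is, the first component of its lexicographic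
solution (see `SLS.IsLexMin.eq_sInf`). -/
def gammaStar (k T : ℕ) (lam : ℝ) {N : ℕ} (ω : Fin N → Datum n M T) : ℝ :=
  sInf {γ : ℝ | ∃ P, S.ScenarioFeasible k T lam ω γ P}

/-- `(γ, P)` minimizes `(γ, ‖P‖_F)` lexicographically under the constraints `F`. -/
def IsLexMin {ι : Type*} [Fintype ι] (F : ℝ → Matrix ι ι ℝ → Prop) (γ : ℝ) (P : Matrix ι ι ℝ) :
    Prop :=
  F γ P ∧ ∀ γ' P', F γ' P' →
    γ < γ' ∨ (γ = γ' ∧ √(∑ i, ∑ j, P i j ^ 2) ≤ √(∑ i, ∑ j, P' i j ^ 2))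

theorem IsLexMin.eq_sInf {ι : Type*} [Fintype ι] {F : ℝ → Matrix ι ι ℝ → Prop} {γ : ℝ}
    {P : Matrix ι ι ℝ} (h : IsLexMin F γ P) : γ = sInf {γ' : ℝ | ∃ P', F γ' P'} := by
  have hl : IsLeast {γ' : ℝ | ∃ P', F γ' P'} γ := by
    refine ⟨⟨P, h.1⟩, ?_⟩
    rintro γ' ⟨P', hP'⟩
    rcases h.2 γ' P' hP' with h' | h'
    · exact h'.le
    · exact h'.1.le
  exact hl.csInf_eq.symm

end

end SLS

noncomputable section

/-- The uniform probability measure on the unit sphere: the normalized surface measure. -/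
def sphereUniform (n : ℕ) : Measure (UnitSphere n) :=
  (volume : Measure (EuclideanSpace ℝ (Fin n))).toSphere[|Set.univ]

/-- The law of one datum: uniform initial state, independent i.i.d. uniform modes. -/
def datumLaw (n M T : ℕ) : Measure (Datum n M T) :=
  (sphereUniform n).prod (Measure.pi fun _ : Fin T => uniformOn (Set.univ : Set (Fin M)))

/-- The law of a sample of `N` i.i.d. data. -/
def sampleLaw (n M T N : ℕ) : Measure (Fin N → Datum n M T) :=
  Measure.pi fun _ : Fin N => datumLaw n M T

/-- The sample complexity: the least `N` such that `γ° ≤ (1 + ε) γ*(ω_N)` with probability at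
least `1 - β`, and `⊤` if there is none. -/
def SLS.sampleComplexity {n p M : ℕ} (S : SLS n p M) (k T : ℕ) (lam ε β : ℝ) : ℕ∞ :=
  ⨅ (N : ℕ) (_ : ENNReal.ofReal (1 - β) ≤ sampleLaw n M T N
      {ω | S.gammaRobust k T ≤ (1 + ε) * S.gammaStar k T lam ω}), (N : ℕ∞)

/-- The regularized incomplete beta function `I(x; a, b)`. -/
def regBeta (x a b : ℝ) : ℝ :=
  (∫ t in (0 : ℝ)..x, t ^ (a - 1) * (1 - t) ^ (b - 1)) /
    ∫ t in (0 : ℝ)..1, t ^ (a - 1) * (1 - t) ^ (b - 1)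

/-- `φ(ϵ; d, N) = 1 - I(ϵ; d, N - d + 1)`, for `N ≥ d`. -/
def phiTail (e : ℝ) (d N : ℕ) : ℝ := 1 - regBeta e d ((N : ℝ) - d + 1)

/-- The least `N` (`≥ d`, so that `φ(ϵ; d, N)` makes sense) with `φ(ϵ; d, N) ≤ β`, and `⊤` if there
is none. -/
def nPhi (d : ℕ) (e β : ℝ) : ℕ∞ :=
  ⨅ (N : ℕ) (_ : d ≤ N ∧ phiTail e d N ≤ β), (N : ℕ∞)

/-- The level at which `nPhi` is evaluated to guarantee the relative precision `ε`:
`I(1 - (1+ε)^{-2(T-k)}; (n-1)/2, 1/2) / (M^T √((c lam)^{n-1}))`. -/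
def precisionLevel (n M k T : ℕ) (c lam ε : ℝ) : ℝ :=
  regBeta (1 - 1 / (1 + ε) ^ (2 * (T - k))) (((n : ℝ) - 1) / 2) (1 / 2) /
    ((M : ℝ) ^ T * √((c * lam) ^ (n - 1)))

end

/-!
A matrix `P` is feasible for a datum when it lies in a closed convex set depending on that datum, so
(i) bounds the probability `f N` that `N` independent random closed convex sets in a space of
dimension `d - 1` have a common point, when every point is missed with probability at least `e`.
Among `N + 1` sets with a common point, call one essential if leaving it out lowers the least norm
of a common point. By Helly's theorem at most `d` sets are essential, while the set added to `N`
others is essential as soon as it misses their point of least norm; hence `(N + 1) * e * f N ≤ d`.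
Submultiplicativity of `f` turns this into a bound that is exponential in `N` for large `N`, and
counting the infeasible subfamilies of size `N` of a larger family covers small `N`. Up to a
constant factor in `e`, which `c` absorbs, the two bounds are below `φ`.

If `(1 + ε) γ < γ°`, every `P` has a word along which its energy grows by at least `γ°` for some
initial state. The energy at the end stays above the level `γ` in a cone about such a state of
maximal growth, which gives the violation probability `e`. The dimension drops by one because the
constraints are homogeneous in `P`, whose trace can be normalised.

For (ii), a matrix feasible at the level `γ` is a norm in which every word contracts at the rate
`γ`, so `ρ(Σ) ≤ γ°`.
-/

theorem measurePreserving_pi_comp_of_injective {ι κ Ω : Type*} [Fintype ι] [Fintype κ]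
    [MeasurableSpace Ω] (μ : Measure Ω) [IsProbabilityMeasure μ] {f : κ → ι}
    (hf : Function.Injective f) :
    MeasurePreserving (fun ω : ι → Ω => ω ∘ f) (Measure.pi fun _ => μ)
      (Measure.pi fun _ => μ) := by
  have hindep : iIndepFun (fun (j : κ) (ω : ι → Ω) => ω (f j)) (Measure.pi fun _ => μ) :=
    (iIndepFun_pi fun _ => aemeasurable_id).precomp hf
  refine ⟨by fun_prop, ?_⟩
  have hmap := (iIndepFun_iff_map_fun_eq_pi_map fun j => (measurable_pi_apply _).aemeasurable).1
    hindep
  simp only [(measurePreserving_eval (fun _ : ι => μ) _).map_eq] at hmap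
  exact hmap

section DoubleCounting

variable {α ι : Type*} [MeasurableSpace α] (μ : Measure α) (s : Finset ι) {A : ι → Set α}

open Classical in
theorem lintegral_card_filter_mem (hA : ∀ i ∈ s, MeasurableSet (A i)) :
    ∫⁻ ω, (s.filter fun i => ω ∈ A i).card ∂μ = ∑ i ∈ s, μ (A i) := by
  calc ∫⁻ ω, (s.filter fun i => ω ∈ A i).card ∂μ
      = ∫⁻ ω, ∑ i ∈ s, (A i).indicator 1 ω ∂μ := by simp [Set.indicator_apply]
    _ = ∑ i ∈ s, ∫⁻ ω, (A i).indicator 1 ω ∂μ :=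
        lintegral_finsetSum' _ fun i hi => (measurable_one.indicator (hA i hi)).aemeasurable
    _ = ∑ i ∈ s, μ (A i) :=
        Finset.sum_congr rfl fun i hi => lintegral_indicator_one (hA i hi)

open Classical in
theorem sum_measure_le_of_card_filter_mem_le [IsProbabilityMeasure μ]
    (hA : ∀ i ∈ s, MeasurableSet (A i)) {m : ℕ}
    (h : ∀ ω, (s.filter fun i => ω ∈ A i).card ≤ m) : ∑ i ∈ s, μ (A i) ≤ m := by
  rw [← lintegral_card_filter_mem μ s hA]
  exact (lintegral_mono fun ω => Nat.cast_le.2 (h ω)).trans (by simp)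

open Classical in
theorem mul_measure_le_sum_of_le_card_filter_mem (hA : ∀ i ∈ s, MeasurableSet (A i))
    {D : Set α} (hD : MeasurableSet D) {m : ℕ}
    (h : ∀ ω ∈ D, m ≤ (s.filter fun i => ω ∈ A i).card) : m * μ D ≤ ∑ i ∈ s, μ (A i) := by
  rw [← lintegral_card_filter_mem μ s hA, ← setLIntegral_const]
  exact (setLIntegral_mono' hD fun ω hω => Nat.cast_le.2 (h ω hω)).trans
    (setLIntegral_le_lintegral _ _)

end DoubleCounting

theorem choose_le_card_filter_subset_powersetCard {ι : Type*} [Fintype ι] [DecidableEq ι]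
    (I : Finset ι) (m : ℕ) :
    (Fintype.card ι - I.card).choose m ≤
      ((Finset.univ.powersetCard (I.card + m)).filter fun J : Finset ι => I ⊆ J).card := by
  rw [← Finset.card_compl, ← Finset.card_powersetCard]
  have hdisj : ∀ J ∈ Iᶜ.powersetCard m, Disjoint J I := fun J hJ =>
    Finset.subset_compl_iff_disjoint_right.1 (Finset.mem_powersetCard.1 hJ).1
  refine Finset.card_le_card_of_injOn (fun J => J ∪ I) (fun J hJ => ?_) fun J hJ J' hJ' h => ?_
  · have hcard : (J ∪ I).card = I.card + m := by
      rw [Finset.card_union_of_disjoint (hdisj J hJ), (Finset.mem_powersetCard.1 hJ).2, add_comm]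
    simp [hcard]
  · calc J = (J ∪ I) \ I := (Finset.union_sdiff_cancel_right (hdisj J hJ)).symm
      _ = (J' ∪ I) \ I := congrArg (· \ I) h
      _ = J' := Finset.union_sdiff_cancel_right (hdisj J' hJ')

section LeastNorm

variable {E : Type*} [NormedAddCommGroup E]

theorem exists_forall_norm_le_of_isClosed [ProperSpace E] {K : Set E} (hK : IsClosed K)
    (hne : K.Nonempty) : ∃ x₀ ∈ K, ∀ x ∈ K, ‖x₀‖ ≤ ‖x‖ := by
  obtain ⟨x₀, hx₀, hdist⟩ := hK.exists_infDist_eq_dist hne 0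
  refine ⟨x₀, hx₀, fun x hx => ?_⟩
  simpa [hdist] using Metric.infDist_le_dist_of_mem (x := (0 : E)) hx

theorem exists_rat_norm_level [NormedSpace ℝ E] [StrictConvexSpace ℝ E] [ProperSpace E]
    {K L : Set E} (hK : Convex ℝ K) (hL : IsClosed L) (hLK : L ⊆ K) {x₀ : E} (hx₀ : x₀ ∈ K)
    (hmin : ∀ x ∈ K, ‖x₀‖ ≤ ‖x‖) (hx₀L : x₀ ∉ L) :
    ∃ q : ℚ, ‖x₀‖ ≤ q ∧ ∀ x ∈ L, (q : ℝ) < ‖x‖ := by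
  rcases L.eq_empty_or_nonempty with rfl | hne
  · obtain ⟨q, hq⟩ := exists_rat_gt ‖x₀‖
    exact ⟨q, hq.le, by simp⟩
  obtain ⟨x₁, hx₁, hmin₁⟩ := exists_forall_norm_le_of_isClosed hL hne
  have hlt : ‖x₀‖ < ‖x₁‖ := by
    refine lt_of_le_of_ne (hmin _ (hLK hx₁)) fun heq => ?_
    have hmid : (1 / 2 : ℝ) • x₀ + (1 / 2 : ℝ) • x₁ ∈ K :=
      hK hx₀ (hLK hx₁) (by norm_num) (by norm_num) (by norm_num)
    have hmid_lt : ‖(1 / 2 : ℝ) • x₀ + (1 / 2 : ℝ) • x₁‖ < ‖x₀‖ :=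
      norm_combo_lt_of_ne le_rfl heq.ge (fun h => hx₀L (h ▸ hx₁)) (by norm_num) (by norm_num)
        (by norm_num)
    exact (hmin _ hmid).not_gt hmid_lt
  obtain ⟨q, hq, hq'⟩ := exists_rat_btwn hlt
  exact ⟨q, hq.le, fun x hx => hq'.trans_le (hmin₁ x hx)⟩

end LeastNorm

section RandomConvexSets

variable {Ω E ι : Type*}

/-- The samples `ω` for which the random sets `C (ω i)`, `i ∈ s`, have a common point. -/
def feasibleSamples (C : Ω → Set E) (s : Finset ι) : Set (ι → Ω) :=
  {ω | (⋂ i ∈ s, C (ω i)).Nonempty}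

/-- The samples `ω` for which the random sets `C (ω i)`, `i ∈ s`, have a common point of norm at
most `q`. The least such `q` is the level of the family, which may be infinite. -/
def boundedlyFeasibleSamples [NormedAddCommGroup E] (C : Ω → Set E) (s : Finset ι) (q : ℝ) :
    Set (ι → Ω) :=
  {ω | (Metric.closedBall 0 q ∩ ⋂ i ∈ s, C (ω i)).Nonempty}

/-- The samples whose level (the least norm of a common point) drops when the `i`-th set is left
out. Rational witnesses make the event a countable union. -/
def essentialSamples [NormedAddCommGroup E] [Fintype ι] [DecidableEq ι] (C : Ω → Set E) (i : ι) :
    Set (ι → Ω) :=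
  ⋃ q : ℚ, boundedlyFeasibleSamples C (Finset.univ.erase i) (q : ℝ) \
    boundedlyFeasibleSamples C Finset.univ (q : ℝ)

/-- The probability that `N` independent copies of the random set `C` have a common point. -/
noncomputable def feasibilityProb [MeasurableSpace Ω] (μ : Measure Ω) (C : Ω → Set E) (N : ℕ) : ℝ :=
  (Measure.pi fun _ : Fin N => μ).real (feasibleSamples C Finset.univ)

theorem feasibleSamples_anti (C : Ω → Set E) {s t : Finset ι} (h : s ⊆ t) :
    feasibleSamples C t ⊆ feasibleSamples C s :=
  fun _ hω => hω.mono (Set.biInter_subset_biInter_left h)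

theorem feasibleSamples_map {κ : Type*} (C : Ω → Set E) (f : κ ↪ ι) (s : Finset κ) :
    feasibleSamples C (s.map f) = (fun ω : ι → Ω => ω ∘ f) ⁻¹' feasibleSamples C s := by
  simp [feasibleSamples, Set.preimage]

theorem feasibleSamples_eq_iUnion [NormedAddCommGroup E] (C : Ω → Set E) (s : Finset ι) :
    feasibleSamples C s = ⋃ m : ℕ, boundedlyFeasibleSamples C s m := by
  ext ω
  rw [Set.mem_iUnion]
  refine ⟨fun ⟨x, hx⟩ => ?_, fun ⟨m, hm⟩ => hm.mono Set.inter_subset_right⟩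
  obtain ⟨m, hm⟩ := exists_nat_ge ‖x‖
  exact ⟨m, x, by simpa using hm, hx⟩

section Measurability

variable [NormedAddCommGroup E] [ProperSpace E] [TopologicalSpace Ω] {C : Ω → Set E}

theorem isClosed_boundedlyFeasibleSamples (hC : IsClosed {p : Ω × E | p.2 ∈ C p.1})
    (s : Finset ι) (q : ℝ) : IsClosed (boundedlyFeasibleSamples C s q) := by
  have : CompactSpace (Metric.closedBall (0 : E) q) :=
    isCompact_iff_compactSpace.1 (isCompact_closedBall 0 q)
  have hF : IsClosed
      {p : Metric.closedBall (0 : E) q × (ι → Ω) | ∀ i ∈ s, (p.1 : E) ∈ C (p.2 i)} := by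
    simp only [Set.ofPred_forall]
    exact isClosed_iInter fun i => isClosed_iInter fun _ => hC.preimage
      (f := fun p : Metric.closedBall (0 : E) q × (ι → Ω) => (p.2 i, (p.1 : E))) (by fun_prop)
  convert isClosedMap_snd_of_compactSpace _ hF using 1
  ext ω
  simp [boundedlyFeasibleSamples, Set.Nonempty]

variable [MeasurableSpace Ω] [BorelSpace Ω] [SecondCountableTopology Ω]

theorem measurableSet_boundedlyFeasibleSamples [Countable ι]
    (hC : IsClosed {p : Ω × E | p.2 ∈ C p.1}) (s : Finset ι) (q : ℝ) :
    MeasurableSet (boundedlyFeasibleSamples C s q) :=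
  (isClosed_boundedlyFeasibleSamples hC s q).measurableSet

theorem measurableSet_feasibleSamples [Countable ι] (hC : IsClosed {p : Ω × E | p.2 ∈ C p.1})
    (s : Finset ι) : MeasurableSet (feasibleSamples C s) := by
  rw [feasibleSamples_eq_iUnion]
  exact MeasurableSet.iUnion fun m => measurableSet_boundedlyFeasibleSamples hC _ _

theorem measurableSet_essentialSamples [Fintype ι] [DecidableEq ι]
    (hC : IsClosed {p : Ω × E | p.2 ∈ C p.1}) (i : ι) : MeasurableSet (essentialSamples C i) :=
  MeasurableSet.iUnion fun _ => (measurableSet_boundedlyFeasibleSamples hC _ _).diff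
    (measurableSet_boundedlyFeasibleSamples hC _ _)

end Measurability

section Helly

variable [NormedAddCommGroup E] [NormedSpace ℝ E] [FiniteDimensional ℝ E] [Fintype ι]
  {C : Ω → Set E}

-- Otherwise any `dim E + 1` sets omit an essential one, so they meet in the ball of the largest
-- witnessing radius, and by Helly's theorem so does the whole family.
open Classical in
theorem card_essential_le_finrank_add_one (hC : ∀ δ, Convex ℝ (C δ)) (ω : ι → Ω) :
    (Finset.univ.filter fun i => ω ∈ essentialSamples C i).card ≤ Module.finrank ℝ E + 1 := by
  set J := Finset.univ.filter fun i => ω ∈ essentialSamples C i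
  by_contra! hcard
  have hess : ∀ i ∈ J, ∃ q : ℚ, ω ∈ boundedlyFeasibleSamples C (Finset.univ.erase i) q ∧
      ω ∉ boundedlyFeasibleSamples C Finset.univ q := fun i hi =>
    Set.mem_iUnion.1 (Finset.mem_filter.1 hi).2
  choose! q hq hq' using hess
  obtain ⟨i₀, hi₀, hmax⟩ := J.exists_max_image q (Finset.card_pos.1 (by omega))
  have hcommon : (⋂ i ∈ Finset.univ, Metric.closedBall (0 : E) (q i₀) ∩ C (ω i)).Nonempty := by
    refine Convex.helly_theorem' (𝕜 := ℝ) (fun i _ => (convex_closedBall _ _).inter (hC _))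
      fun I _ hI => ?_
    obtain ⟨j, hj, hjI⟩ := Finset.exists_mem_notMem_of_card_lt_card (hI.trans_lt hcard)
    obtain ⟨x, hx, hxC⟩ := hq j hj
    refine ⟨x, Set.mem_iInter₂.2 fun i hi => ⟨?_, Set.mem_iInter₂.1 hxC i ?_⟩⟩
    · exact Metric.closedBall_subset_closedBall (by exact_mod_cast hmax j hj) hx
    · exact Finset.mem_erase.2 ⟨fun h => hjI (h ▸ hi), Finset.mem_univ _⟩
  obtain ⟨x, hx⟩ := hcommon
  simp only [Set.mem_iInter, Finset.mem_univ, true_imp_iff, Set.mem_inter_iff] at hx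
  exact hq' i₀ hi₀ ⟨x, (hx i₀).1, by simpa using fun i => (hx i).2⟩

theorem exists_infeasible_subfamily (hC : ∀ δ, Convex ℝ (C δ)) {d : ℕ}
    (hd : Module.finrank ℝ E + 1 ≤ d) (hι : d ≤ Fintype.card ι) {ω : ι → Ω}
    (hω : ω ∉ feasibleSamples C Finset.univ) :
    ∃ I : Finset ι, I.card = d ∧ ω ∉ feasibleSamples C I := by
  by_contra! h
  refine hω (Convex.helly_theorem' (𝕜 := ℝ) (fun i _ => hC _) fun I _ hI => ?_)
  obtain ⟨I', hI', hcard⟩ := Finset.exists_superset_card_eq (hI.trans hd) hι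
  exact feasibleSamples_anti C hI' (h I' hcard)

end Helly

section FeasibilityProb

variable [NormedAddCommGroup E] [TopologicalSpace Ω] [MeasurableSpace Ω] [BorelSpace Ω]
  [SecondCountableTopology Ω] (μ : Measure Ω) [IsProbabilityMeasure μ] {C : Ω → Set E}

section ProperSpace

variable [ProperSpace E]

theorem measureReal_feasibleSamples [Fintype ι] (hC : IsClosed {p : Ω × E | p.2 ∈ C p.1})
    (s : Finset ι) :
    (Measure.pi fun _ : ι => μ).real (feasibleSamples C s) = feasibilityProb μ C s.card := by
  set f : Fin s.card ↪ ι := s.equivFin.symm.toEmbedding.trans (.subtype _)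
  have hs : s = Finset.univ.map f := by
    rw [← Finset.map_map, Finset.map_univ_equiv, Finset.univ_eq_attach, Finset.attach_map_val]
  conv_lhs => rw [hs, feasibleSamples_map]
  exact (measurePreserving_pi_comp_of_injective μ f.injective).measureReal_preimage
    (measurableSet_feasibleSamples hC _).nullMeasurableSet

theorem feasibilityProb_add_le (hC : IsClosed {p : Ω × E | p.2 ∈ C p.1}) (a b : ℕ) :
    feasibilityProb μ C (a + b) ≤ feasibilityProb μ C a * feasibilityProb μ C b := by
  have hsplit := (measurePreserving_sumPiEquivProdPi fun _ : Fin a ⊕ Fin b => μ).comp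
    (measurePreserving_pi_comp_of_injective μ (finSumFinEquiv (m := a) (n := b)).injective)
  rw [feasibilityProb, feasibilityProb, feasibilityProb, ← measureReal_prod_prod,
    ← hsplit.measureReal_preimage ((measurableSet_feasibleSamples hC _).prod
      (measurableSet_feasibleSamples hC _)).nullMeasurableSet]
  refine measureReal_mono ?_
  rintro ω ⟨x, hx⟩
  simp only [Set.mem_iInter, Finset.mem_univ, true_imp_iff] at hx
  exact ⟨⟨x, Set.mem_iInter₂.2 fun i _ => hx _⟩, ⟨x, Set.mem_iInter₂.2 fun i _ => hx _⟩⟩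

theorem feasibilityProb_antitone (hC : IsClosed {p : Ω × E | p.2 ∈ C p.1}) :
    Antitone (feasibilityProb μ C) := by
  intro a b hab
  obtain ⟨c, rfl⟩ := Nat.exists_eq_add_of_le hab
  exact (feasibilityProb_add_le μ hC a c).trans
    (mul_le_of_le_one_right measureReal_nonneg measureReal_le_one)

theorem feasibilityProb_mul_le_pow (hC : IsClosed {p : Ω × E | p.2 ∈ C p.1}) (a m : ℕ) :
    feasibilityProb μ C (m * a) ≤ feasibilityProb μ C a ^ m := by
  induction m with
  | zero => simp [feasibilityProb]
  | succ m ih =>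
    rw [Nat.succ_mul, pow_succ]
    exact (feasibilityProb_add_le μ hC _ _).trans
      (mul_le_mul_of_nonneg_right ih measureReal_nonneg)

end ProperSpace

section StrictConvex

variable [NormedSpace ℝ E] [StrictConvexSpace ℝ E] [FiniteDimensional ℝ E]

-- Given the other sets, the `i`-th one is essential as soon as it misses their point of least norm.
theorem mul_measure_feasibleSamples_le_essentialSamples (hconv : ∀ δ, Convex ℝ (C δ))
    (hC : IsClosed {p : Ω × E | p.2 ∈ C p.1}) {e : ENNReal} (he : ∀ x, e ≤ μ {δ | x ∉ C δ})
    (N : ℕ) (i : Fin (N + 1)) :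
    e * (Measure.pi fun _ : Fin N => μ) (feasibleSamples C Finset.univ) ≤
      (Measure.pi fun _ : Fin (N + 1) => μ) (essentialSamples C i) := by
  have := FiniteDimensional.proper ℝ E
  have hCδ : ∀ δ, IsClosed (C δ) := fun δ => hC.preimage (f := fun x : E => (δ, x)) (by fun_prop)
  have hmeas := measurableSet_essentialSamples hC i
  have hmp := (measurePreserving_piFinSuccAbove (fun _ : Fin (N + 1) => μ) i).symm
  rw [← hmp.measure_preimage hmeas.nullMeasurableSet,
    Measure.prod_apply_symm (hmp.measurable hmeas), ← setLIntegral_const]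
  refine (setLIntegral_mono' (measurableSet_feasibleSamples hC _) fun ω hω => ?_).trans
    (setLIntegral_le_lintegral _ _)
  set K := ⋂ j ∈ Finset.univ, C (ω j) with hK
  have hKconv : Convex ℝ K := convex_iInter₂ fun j _ => hconv _
  have hKclosed : IsClosed K := isClosed_biInter fun j _ => hCδ _
  obtain ⟨x₀, hx₀, hmin⟩ := exists_forall_norm_le_of_isClosed hKclosed hω
  refine (he x₀).trans (measure_mono fun δ hδ => ?_)
  obtain ⟨q, hq, hq'⟩ := exists_rat_norm_level hKconv (hKclosed.inter (hCδ δ))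
    Set.inter_subset_left hx₀ hmin fun h => hδ h.2
  simp only [hK, Set.mem_iInter, Finset.mem_univ, true_imp_iff] at hx₀
  refine Set.mem_iUnion.2 ⟨q, ⟨x₀, by simpa using hq, Set.mem_iInter₂.2 fun j hj => ?_⟩, ?_⟩
  · obtain ⟨l, rfl⟩ := Fin.exists_succAbove_eq (Finset.ne_of_mem_erase hj)
    simpa [MeasurableEquiv.piFinSuccAbove, Fin.insertNthEquiv] using hx₀ l
  · rintro ⟨x, hxq, hxC⟩
    simp only [Set.mem_iInter, Finset.mem_univ, true_imp_iff] at hxC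
    refine (hq' x ⟨Set.mem_iInter₂.2 fun l _ => ?_, ?_⟩).not_ge (by simpa using hxq)
    · simpa [MeasurableEquiv.piFinSuccAbove, Fin.insertNthEquiv] using hxC (i.succAbove l)
    · simpa [MeasurableEquiv.piFinSuccAbove, Fin.insertNthEquiv] using hxC i

theorem succ_mul_feasibilityProb_le (hconv : ∀ δ, Convex ℝ (C δ))
    (hC : IsClosed {p : Ω × E | p.2 ∈ C p.1}) {e : ℝ} (he : ∀ x, e ≤ μ.real {δ | x ∉ C δ})
    (N : ℕ) : (N + 1) * (e * feasibilityProb μ C N) ≤ Module.finrank ℝ E + 1 := by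
  classical
  have := FiniteDimensional.proper ℝ E
  set f := (Measure.pi fun _ : Fin N => μ) (feasibleSamples C Finset.univ)
  have he' : ∀ x, ENNReal.ofReal e ≤ μ {δ | x ∉ C δ} := fun x => by
    rw [ENNReal.ofReal_le_iff_le_toReal (measure_ne_top _ _)]
    exact he x
  have hsum : (N + 1 : ℕ) * (ENNReal.ofReal e * f) ≤ (Module.finrank ℝ E + 1 : ℕ) := by
    calc (N + 1 : ℕ) * (ENNReal.ofReal e * f)
        = ∑ _i : Fin (N + 1), ENNReal.ofReal e * f := by simp
      _ ≤ ∑ i : Fin (N + 1), (Measure.pi fun _ : Fin (N + 1) => μ) (essentialSamples C i) :=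
          Finset.sum_le_sum fun i _ =>
            mul_measure_feasibleSamples_le_essentialSamples μ hconv hC he' N i
      _ ≤ (Module.finrank ℝ E + 1 : ℕ) := sum_measure_le_of_card_filter_mem_le _ _
          (fun i _ => measurableSet_essentialSamples hC i)
          fun ω => by convert card_essential_le_finrank_add_one hconv ω
  have hreal : ((N + 1 : ℕ) : ℝ) * ((ENNReal.ofReal e).toReal * f.toReal) ≤
      (Module.finrank ℝ E + 1 : ℕ) := by
    simpa only [ENNReal.toReal_mul, ENNReal.toReal_natCast] using
      ENNReal.toReal_mono (ENNReal.natCast_ne_top _) hsum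
  have he_le : e ≤ (ENNReal.ofReal e).toReal := ENNReal.toReal_ofReal' ▸ le_max_left e 0
  calc (N + 1) * (e * feasibilityProb μ C N)
      ≤ (N + 1) * ((ENNReal.ofReal e).toReal * f.toReal) :=
        mul_le_mul_of_nonneg_left (mul_le_mul_of_nonneg_right he_le ENNReal.toReal_nonneg)
          (by positivity)
    _ ≤ Module.finrank ℝ E + 1 := by exact_mod_cast hreal

end StrictConvex

end FeasibilityProb

end RandomConvexSets

section RandomConvexSets

variable {Ω E : Type*} [NormedAddCommGroup E] [NormedSpace ℝ E] [FiniteDimensional ℝ E]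
  [TopologicalSpace Ω] [MeasurableSpace Ω] [BorelSpace Ω] [SecondCountableTopology Ω]
  (μ : Measure Ω) [IsProbabilityMeasure μ] {C : Ω → Set E}

-- An infeasible sample of size `N₀` contains an infeasible one of size `d`, hence
-- `(N₀ - d).choose (N - d)` infeasible ones of size `N`.
theorem choose_sub_mul_one_sub_feasibilityProb_le (hconv : ∀ δ, Convex ℝ (C δ))
    (hC : IsClosed {p : Ω × E | p.2 ∈ C p.1}) {d N N₀ : ℕ} (hd : Module.finrank ℝ E + 1 ≤ d)
    (hdN : d ≤ N) (hN : N ≤ N₀) :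
    ((N₀ - d).choose (N - d) : ℝ) * (1 - feasibilityProb μ C N₀) ≤
      N₀.choose N * (1 - feasibilityProb μ C N) := by
  classical
  have := FiniteDimensional.proper ℝ E
  set P := Measure.pi fun _ : Fin N₀ => μ
  set 𝒥 := (Finset.univ : Finset (Fin N₀)).powersetCard N
  have hmeas : ∀ J : Finset (Fin N₀), MeasurableSet (feasibleSamples C J)ᶜ := fun J =>
    (measurableSet_feasibleSamples hC J).compl
  have hcount : ∀ ω ∈ (feasibleSamples C (Finset.univ : Finset (Fin N₀)))ᶜ,
      (N₀ - d).choose (N - d) ≤ (𝒥.filter fun J => ω ∈ (feasibleSamples C J)ᶜ).card := by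
    intro ω hω
    obtain ⟨I, rfl, hI⟩ :=
      exists_infeasible_subfamily hconv hd (by simpa using hdN.trans hN) hω
    have hsupersets := choose_le_card_filter_subset_powersetCard I (N - I.card)
    rw [Fintype.card_fin, Nat.add_sub_cancel' hdN] at hsupersets
    refine hsupersets.trans (Finset.card_le_card ?_)
    exact Finset.monotone_filter_right _ fun J _ hIJ h => hI (feasibleSamples_anti C hIJ h)
  have hreal : ∀ J : Finset (Fin N₀),
      P.real (feasibleSamples C J)ᶜ = 1 - feasibilityProb μ C J.card := fun J => by
    rw [probReal_compl_eq_one_sub (measurableSet_feasibleSamples hC J),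
      measureReal_feasibleSamples μ hC]
  have hmeasure := ENNReal.toReal_mono
    (ENNReal.sum_ne_top.2 fun J _ => measure_ne_top P (feasibleSamples C J)ᶜ)
    (mul_measure_le_sum_of_le_card_filter_mem P 𝒥 (fun J _ => hmeas J) (hmeas _)
      fun ω hω => by convert hcount ω hω)
  rw [ENNReal.toReal_mul, ENNReal.toReal_natCast, ENNReal.toReal_sum fun J _ =>
    measure_ne_top P _] at hmeasure
  calc ((N₀ - d).choose (N - d) : ℝ) * (1 - feasibilityProb μ C N₀)
      = (N₀ - d).choose (N - d) * P.real (feasibleSamples C Finset.univ)ᶜ := by simp [hreal]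
    _ ≤ ∑ J ∈ 𝒥, P.real (feasibleSamples C J)ᶜ := hmeasure
    _ = ∑ J ∈ 𝒥, (1 - feasibilityProb μ C N) := Finset.sum_congr rfl fun J hJ => by
        rw [hreal, (Finset.mem_powersetCard.1 hJ).2]
    _ = N₀.choose N * (1 - feasibilityProb μ C N) := by
        rw [Finset.sum_const, Finset.card_powersetCard, Finset.card_univ, Fintype.card_fin,
          nsmul_eq_mul]

theorem choose_mul_one_sub_feasibilityProb_le (hconv : ∀ δ, Convex ℝ (C δ))
    (hC : IsClosed {p : Ω × E | p.2 ∈ C p.1}) {d N N₀ : ℕ} (hd : Module.finrank ℝ E + 1 ≤ d)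
    (hdN : d ≤ N) (hN : N ≤ N₀) :
    (N.choose d : ℝ) * (1 - feasibilityProb μ C N₀) ≤
      N₀.choose d * (1 - feasibilityProb μ C N) := by
  have hchoose : (N₀.choose N : ℝ) * N.choose d = N₀.choose d * (N₀ - d).choose (N - d) := by
    exact_mod_cast Nat.choose_mul (n := N₀) hdN
  refine le_of_mul_le_mul_left ?_ (Nat.cast_pos.2 (Nat.choose_pos hN) : (0 : ℝ) < N₀.choose N)
  calc (N₀.choose N : ℝ) * (N.choose d * (1 - feasibilityProb μ C N₀))
      = N₀.choose d * ((N₀ - d).choose (N - d) * (1 - feasibilityProb μ C N₀)) := by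
        rw [← mul_assoc, hchoose, mul_assoc]
    _ ≤ N₀.choose d * (N₀.choose N * (1 - feasibilityProb μ C N)) :=
        mul_le_mul_of_nonneg_left
          (choose_sub_mul_one_sub_feasibilityProb_le μ hconv hC hd hdN hN) (Nat.cast_nonneg _)
    _ = N₀.choose N * (N₀.choose d * (1 - feasibilityProb μ C N)) := by ring

theorem feasibilityProb_le_one_sub_choose_mul_pow (hconv : ∀ δ, Convex ℝ (C δ))
    (hC : IsClosed {p : Ω × E | p.2 ∈ C p.1}) {d N N₀ : ℕ} (hd : Module.finrank ℝ E + 1 ≤ d)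
    (hdN : d ≤ N) (hN : N ≤ N₀) (hhalf : feasibilityProb μ C N₀ ≤ 1 / 2) {e : ℝ} (he : 0 ≤ e)
    (hN₀e : N₀ * e ≤ 1 / 2) : feasibilityProb μ C N ≤ 1 - N.choose d * e ^ d := by
  have hchoose : (N₀.choose d : ℝ) * e ^ d ≤ 1 / 2 := by
    calc (N₀.choose d : ℝ) * e ^ d ≤ (N₀ : ℝ) ^ d * e ^ d := by
          gcongr
          exact_mod_cast Nat.choose_le_pow N₀ d
      _ = (N₀ * e) ^ d := (mul_pow _ _ _).symm
      _ ≤ (1 / 2) ^ d := by gcongr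
      _ ≤ (1 / 2) ^ 1 := pow_le_pow_of_le_one (by norm_num) (by norm_num) (by omega)
      _ = 1 / 2 := pow_one _
  have hpos : (0 : ℝ) < N₀.choose d := by exact_mod_cast Nat.choose_pos (hdN.trans hN)
  have hscaled : (N₀.choose d : ℝ) * (N.choose d * e ^ d) ≤
      N₀.choose d * (1 - feasibilityProb μ C N) := by
    calc (N₀.choose d : ℝ) * (N.choose d * e ^ d) = N.choose d * (N₀.choose d * e ^ d) := by ring
      _ ≤ N.choose d * (1 - feasibilityProb μ C N₀) := by gcongr; linarith
      _ ≤ _ := choose_mul_one_sub_feasibilityProb_le μ hconv hC hd hdN hN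
  linarith [le_of_mul_le_mul_left hscaled hpos]

omit [NormedSpace ℝ E] [FiniteDimensional ℝ E] in
theorem feasibilityProb_le_one_sub_pow [ProperSpace E]
    (hC : IsClosed {p : Ω × E | p.2 ∈ C p.1}) {N N₀ : ℕ} (hN₀ : 0 < N₀) (hN : N₀ ≤ N)
    (hhalf : feasibilityProb μ C N₀ ≤ 1 / 2) {e : ℝ} (he : 0 ≤ e) (hN₀e : N₀ * e ≤ 1 / 4) :
    feasibilityProb μ C N ≤ (1 - e) ^ N := by
  set m := N / N₀
  have hm : 1 ≤ m := (Nat.one_le_div_iff hN₀).2 hN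
  have hN_le : N ≤ 2 * N₀ * m := by
    have : N < m * N₀ + N₀ := Nat.lt_div_mul_add hN₀
    nlinarith
  have he1 : e ≤ 1 := by
    have : (1 : ℝ) ≤ N₀ := by exact_mod_cast hN₀
    nlinarith
  have hbernoulli : 1 / 2 ≤ (1 - e) ^ (2 * N₀) := by
    have := one_add_mul_le_pow (a := -e) (by linarith) (2 * N₀)
    push_cast at this
    rw [← sub_eq_add_neg] at this
    linarith
  calc feasibilityProb μ C N ≤ feasibilityProb μ C (m * N₀) :=
        feasibilityProb_antitone μ hC (Nat.div_mul_le_self N N₀)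
    _ ≤ feasibilityProb μ C N₀ ^ m := feasibilityProb_mul_le_pow μ hC _ _
    _ ≤ (1 / 2) ^ m := pow_le_pow_left₀ measureReal_nonneg hhalf m
    _ ≤ ((1 - e) ^ (2 * N₀)) ^ m := by gcongr
    _ = (1 - e) ^ (2 * N₀ * m) := (pow_mul _ _ _).symm
    _ ≤ (1 - e) ^ N := pow_le_pow_of_le_one (by linarith) (by linarith) hN_le

theorem feasibilityProb_le_half [StrictConvexSpace ℝ E] (hconv : ∀ δ, Convex ℝ (C δ))
    (hC : IsClosed {p : Ω × E | p.2 ∈ C p.1}) {e : ℝ} (he : ∀ x, e ≤ μ.real {δ | x ∉ C δ})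
    {N : ℕ} (hN : 2 * (Module.finrank ℝ E + 1) ≤ N * e) : feasibilityProb μ C N ≤ 1 / 2 := by
  have hlevel := succ_mul_feasibilityProb_le μ hconv hC he N
  have hprob : 0 ≤ feasibilityProb μ C N := measureReal_nonneg
  have hd : (0 : ℝ) < Module.finrank ℝ E + 1 := by positivity
  have he0 : 0 ≤ e := by
    by_contra! h
    nlinarith [mul_nonneg (Nat.cast_nonneg (α := ℝ) N) (neg_nonneg.2 h.le)]
  have hscaled : (Module.finrank ℝ E + 1) * (2 * feasibilityProb μ C N) ≤
      (Module.finrank ℝ E + 1) * 1 := by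
    calc (Module.finrank ℝ E + 1) * (2 * feasibilityProb μ C N)
        = 2 * (Module.finrank ℝ E + 1) * feasibilityProb μ C N := by ring
      _ ≤ N * e * feasibilityProb μ C N := by gcongr
      _ ≤ (N + 1) * (e * feasibilityProb μ C N) := by nlinarith [mul_nonneg he0 hprob]
      _ ≤ (Module.finrank ℝ E + 1) * 1 := by linarith
  linarith [le_of_mul_le_mul_left hscaled hd]

-- At `N₀ ≈ 2d / (12de)` samples feasibility has probability at most one half; subsampling covers
-- the sizes below `N₀` and submultiplicativity those above.
theorem feasibilityProb_le_max [StrictConvexSpace ℝ E] (hconv : ∀ δ, Convex ℝ (C δ))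
    (hC : IsClosed {p : Ω × E | p.2 ∈ C p.1}) {d N : ℕ} (hd : Module.finrank ℝ E + 1 ≤ d)
    (hdN : d ≤ N) {e : ℝ} (he : 0 < e) (hmiss : ∀ x, 12 * d * e ≤ μ.real {δ | x ∉ C δ}) :
    feasibilityProb μ C N ≤ max (1 - N.choose d * e ^ d) ((1 - e) ^ N) := by
  have := FiniteDimensional.proper ℝ E
  have hd' : (Module.finrank ℝ E + 1 : ℝ) ≤ d := by exact_mod_cast hd
  have hd1 : (1 : ℝ) ≤ d := le_trans (by simp) hd'
  set q : ℝ := 12 * d * e with hq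
  have hq0 : 0 < q := by positivity
  have hq1 : q ≤ 1 := (hmiss 0).trans measureReal_le_one
  set N₀ : ℕ := ⌈2 * d / q⌉₊
  have hN₀ge : 2 * d / q ≤ (N₀ : ℝ) := Nat.le_ceil _
  have hN₀e : (N₀ : ℝ) * e ≤ 1 / 4 := by
    have hceil : (N₀ : ℝ) ≤ 2 * d / q + 1 := (Nat.ceil_lt_add_one (by positivity)).le
    have hdq : 1 ≤ d / q := (one_le_div hq0).2 (hq1.trans hd1)
    calc (N₀ : ℝ) * e ≤ (2 * d / q + d / q) * e := by gcongr; linarith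
      _ = 1 / 4 := by rw [hq]; field_simp; norm_num
  have hhalf : feasibilityProb μ C N₀ ≤ 1 / 2 :=
    feasibilityProb_le_half μ hconv hC hmiss (by linarith [(div_le_iff₀ hq0).1 hN₀ge])
  rcases le_total N N₀ with hN | hN
  · exact le_max_of_le_left (feasibilityProb_le_one_sub_choose_mul_pow μ hconv hC hd hdN hN hhalf
      he.le (by linarith))
  · have hN₀ : 0 < N₀ := Nat.ceil_pos.2 (by positivity)
    exact le_max_of_le_right (feasibilityProb_le_one_sub_pow μ hC hN₀ hN hhalf he.le hN₀e)

end RandomConvexSets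

section BetaFunction

theorem betaIntegrand_eqOn (a b : ℝ) :
    Set.EqOn (fun t : ℝ => (t : ℂ) ^ ((a : ℂ) - 1) * (1 - (t : ℂ)) ^ ((b : ℂ) - 1))
      (fun t : ℝ => ((t ^ (a - 1) * (1 - t) ^ (b - 1) : ℝ) : ℂ)) (Set.Ioc 0 1) := fun t ht => by
  have h1t : 0 ≤ 1 - t := by linarith [ht.2]
  simp only [Complex.ofReal_mul, Complex.ofReal_cpow ht.1.le, Complex.ofReal_cpow h1t]
  push_cast
  rfl

theorem betaIntegrand_nonneg {t : ℝ} (ht : t ∈ Set.Icc (0 : ℝ) 1) (a b : ℝ) :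
    0 ≤ t ^ (a - 1) * (1 - t) ^ (b - 1) :=
  mul_nonneg (Real.rpow_nonneg ht.1 _) (Real.rpow_nonneg (by linarith [ht.2]) _)

section

variable {a b : ℝ} (ha : 0 < a) (hb : 0 < b)

include ha hb

theorem intervalIntegrable_beta {x y : ℝ} (hx : x ∈ Set.Icc (0 : ℝ) 1)
    (hy : y ∈ Set.Icc (0 : ℝ) 1) :
    IntervalIntegrable (fun t : ℝ => t ^ (a - 1) * (1 - t) ^ (b - 1)) volume x y := by
  have h01 : IntervalIntegrable (fun t : ℝ => t ^ (a - 1) * (1 - t) ^ (b - 1)) volume 0 1 := by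
    have hcomplex := Complex.betaIntegral_convergent (u := a) (v := b) (by simpa) (by simpa)
    rw [intervalIntegrable_iff, Set.uIoc_of_le zero_le_one] at hcomplex ⊢
    simpa [IntegrableOn] using (hcomplex.congr_fun (betaIntegrand_eqOn a b) measurableSet_Ioc).re
  rw [← Set.uIcc_of_le zero_le_one] at hx hy
  exact h01.mono_set (Set.uIcc_subset_uIcc hx hy)

theorem integral_beta : ∫ t in (0 : ℝ)..1, t ^ (a - 1) * (1 - t) ^ (b - 1) = beta a b := by
  rw [beta_eq_betaIntegralReal a b ha hb, Complex.betaIntegral,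
    intervalIntegral.integral_of_le zero_le_one, intervalIntegral.integral_of_le zero_le_one,
    setIntegral_congr_fun measurableSet_Ioc (betaIntegrand_eqOn a b), integral_complex_ofReal,
    Complex.ofReal_re]

theorem beta_add_one_left : beta (a + 1) b = a / (a + b) * beta a b := by
  have hab : a + b ≠ 0 := (add_pos ha hb).ne'
  have hGamma := (Real.Gamma_pos_of_pos (add_pos ha hb)).ne'
  rw [beta, beta, Real.Gamma_add_one ha.ne', add_right_comm, Real.Gamma_add_one hab]
  field_simp

theorem regBeta_eq (x : ℝ) :
    regBeta x a b = (∫ t in (0 : ℝ)..x, t ^ (a - 1) * (1 - t) ^ (b - 1)) / beta a b := by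
  rw [regBeta, integral_beta ha hb]

theorem one_sub_regBeta {x : ℝ} (hx : x ∈ Set.Icc (0 : ℝ) 1) :
    1 - regBeta x a b = (∫ t in x..1, t ^ (a - 1) * (1 - t) ^ (b - 1)) / beta a b := by
  have hB := (beta_pos ha hb).ne'
  rw [regBeta_eq ha hb, eq_div_iff hB, sub_mul, div_mul_cancel₀ _ hB, one_mul,
    ← integral_beta ha hb, ← intervalIntegral.integral_add_adjacent_intervals
      (intervalIntegrable_beta ha hb (Set.left_mem_Icc.2 zero_le_one) hx)
      (intervalIntegrable_beta ha hb hx (Set.right_mem_Icc.2 zero_le_one)), add_sub_cancel_left]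

theorem regBeta_nonneg {x : ℝ} (hx : x ∈ Set.Icc (0 : ℝ) 1) : 0 ≤ regBeta x a b := by
  rw [regBeta_eq ha hb]
  exact div_nonneg (intervalIntegral.integral_nonneg hx.1 fun t ht =>
    betaIntegrand_nonneg ⟨ht.1, ht.2.trans hx.2⟩ a b) (beta_pos ha hb).le

theorem regBeta_le_one {x : ℝ} (hx : x ∈ Set.Icc (0 : ℝ) 1) : regBeta x a b ≤ 1 := by
  rw [← sub_nonneg, one_sub_regBeta ha hb hx]
  exact div_nonneg (intervalIntegral.integral_nonneg hx.2 fun t ht =>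
    betaIntegrand_nonneg ⟨hx.1.trans ht.1, ht.2⟩ a b) (beta_pos ha hb).le

end

theorem regBeta_zero (a b : ℝ) : regBeta 0 a b = 0 := by simp [regBeta]

theorem integral_rpow_sub_one {a : ℝ} (ha : 0 < a) (x : ℝ) :
    ∫ t in (0 : ℝ)..x, t ^ (a - 1) = x ^ a / a := by
  rw [integral_rpow (Or.inl (by linarith))]
  simp [Real.zero_rpow ha.ne']

theorem mul_rpow_le_regBeta {a b x : ℝ} (ha : 0 < a) (hb : 0 < b) (hb1 : b ≤ 1)
    (hx : x ∈ Set.Icc (0 : ℝ) 1) : (a * beta a b)⁻¹ * x ^ a ≤ regBeta x a b := by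
  have hB := beta_pos ha hb
  rw [regBeta_eq ha hb, le_div_iff₀ hB]
  calc (a * beta a b)⁻¹ * x ^ a * beta a b = x ^ a / a := by field_simp
    _ = ∫ t in (0 : ℝ)..x, t ^ (a - 1) := (integral_rpow_sub_one ha x).symm
    _ ≤ ∫ t in (0 : ℝ)..x, t ^ (a - 1) * (1 - t) ^ (b - 1) := by
      refine intervalIntegral.integral_mono_on_of_le_Ioo hx.1
        (intervalIntegral.intervalIntegrable_rpow' (by linarith))
        (intervalIntegrable_beta ha hb (Set.left_mem_Icc.2 zero_le_one) hx) fun t ht => ?_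
      have hfactor : 1 ≤ (1 - t) ^ (b - 1) :=
        Real.one_le_rpow_of_pos_of_le_one_of_nonpos (by linarith [ht.2, hx.2])
          (by linarith [ht.1]) (by linarith)
      exact le_mul_of_one_le_right (Real.rpow_nonneg ht.1.le _) hfactor

theorem regBeta_le_mul_rpow {a b x : ℝ} (ha : 0 < a) (hb : 0 < b) (hb1 : b ≤ 1)
    (hx : x ∈ Set.Icc (0 : ℝ) (1 / 2)) : regBeta x a b ≤ 2 / (a * beta a b) * x ^ a := by
  have hB := beta_pos ha hb
  rw [regBeta_eq ha hb, div_le_iff₀ hB]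
  calc ∫ t in (0 : ℝ)..x, t ^ (a - 1) * (1 - t) ^ (b - 1)
      ≤ ∫ t in (0 : ℝ)..x, t ^ (a - 1) * 2 := by
        refine intervalIntegral.integral_mono_on_of_le_Ioo hx.1
          (intervalIntegrable_beta ha hb (Set.left_mem_Icc.2 zero_le_one)
            ⟨hx.1, by linarith [hx.2]⟩)
          ((intervalIntegral.intervalIntegrable_rpow' (by linarith)).mul_const _) fun t ht => ?_
        refine mul_le_mul_of_nonneg_left ?_ (Real.rpow_nonneg ht.1.le _)
        calc (1 - t) ^ (b - 1) ≤ (1 / 2) ^ (b - 1) :=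
              Real.rpow_le_rpow_of_nonpos (by norm_num) (by linarith [ht.2, hx.2]) (by linarith)
          _ ≤ (1 / 2 : ℝ) ^ (-1 : ℝ) :=
              Real.rpow_le_rpow_of_exponent_ge (by norm_num) (by norm_num) (by linarith)
          _ = 2 := by rw [Real.rpow_neg_one]; norm_num
    _ = 2 / (a * beta a b) * x ^ a * beta a b := by
        rw [intervalIntegral.integral_mul_const, integral_rpow_sub_one ha]
        field_simp

theorem exists_regBeta_le_mul_rpow {a b : ℝ} (ha : 0 < a) (hb : 0 < b) (hb1 : b ≤ 1) :
    ∃ c : ℝ, 0 < c ∧ ∀ x ∈ Set.Icc (0 : ℝ) 1, regBeta x a b ≤ c * x ^ a := by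
  refine ⟨max (2 / (a * beta a b)) (2 ^ a), lt_max_of_lt_right (by positivity), fun x hx => ?_⟩
  have hxa : 0 ≤ x ^ a := Real.rpow_nonneg hx.1 _
  rcases le_total x (1 / 2) with hx2 | hx2
  · exact (regBeta_le_mul_rpow ha hb hb1 ⟨hx.1, hx2⟩).trans
      (mul_le_mul_of_nonneg_right (le_max_left _ _) hxa)
  · calc regBeta x a b ≤ 1 := regBeta_le_one ha hb hx
      _ ≤ (2 * x) ^ a := Real.one_le_rpow (by linarith) ha.le
      _ = 2 ^ a * x ^ a := Real.mul_rpow zero_le_two hx.1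
      _ ≤ _ := mul_le_mul_of_nonneg_right (le_max_right _ _) hxa

end BetaFunction

section PhiTail

variable {d N : ℕ}

theorem betaIntegrand_natCast (hd : 1 ≤ d) (hN : d ≤ N) (t : ℝ) :
    t ^ ((d : ℝ) - 1) * (1 - t) ^ ((N : ℝ) - d + 1 - 1) = t ^ (d - 1) * (1 - t) ^ (N - d) := by
  rw [add_sub_cancel_right, ← Nat.cast_sub hN, ← Nat.cast_one (R := ℝ), ← Nat.cast_sub hd,
    Real.rpow_natCast, Real.rpow_natCast, Nat.cast_one]

theorem integral_pow_mul_one_sub_pow (hd : 1 ≤ d) (hN : d ≤ N) :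
    ∫ t in (0 : ℝ)..1, t ^ (d - 1) * (1 - t) ^ (N - d) = beta d ((N : ℝ) - d + 1) := by
  have hdN : (d : ℝ) ≤ N := by exact_mod_cast hN
  rw [← integral_beta (by exact_mod_cast hd) (by linarith)]
  simp_rw [betaIntegrand_natCast hd hN]

theorem beta_natCast_pos (hd : 1 ≤ d) (hN : d ≤ N) : 0 < beta d ((N : ℝ) - d + 1) := by
  have hdN : (d : ℝ) ≤ N := by exact_mod_cast hN
  exact beta_pos (by exact_mod_cast hd) (by linarith)

theorem natCast_mul_beta_mul_choose (hd : 1 ≤ d) (hN : d ≤ N) :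
    (d : ℝ) * beta d ((N : ℝ) - d + 1) * N.choose d = 1 := by
  have hGd : Real.Gamma d = (d - 1).factorial := by
    rw [← Real.Gamma_nat_eq_factorial, Nat.cast_sub hd, Nat.cast_one, sub_add_cancel]
  have hGN : Real.Gamma ((N : ℝ) - d + 1) = (N - d).factorial := by
    rw [← Real.Gamma_nat_eq_factorial, Nat.cast_sub hN]
  have hchoose : (N.choose d : ℝ) * d.factorial * (N - d).factorial = N.factorial := by
    exact_mod_cast Nat.choose_mul_factorial_mul_factorial hN
  have hfact : (d.factorial : ℝ) = d * (d - 1).factorial := by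
    exact_mod_cast (Nat.mul_factorial_pred (by omega : d ≠ 0)).symm
  have hN0 : (N.factorial : ℝ) ≠ 0 := by exact_mod_cast N.factorial_ne_zero
  rw [beta, hGd, hGN, show (d : ℝ) + (N - d + 1) = N + 1 by ring, Real.Gamma_nat_eq_factorial]
  rw [hfact] at hchoose
  field_simp
  linarith

theorem phiTail_eq (hd : 1 ≤ d) (hN : d ≤ N) {e : ℝ} (he : e ∈ Set.Icc (0 : ℝ) 1) :
    phiTail e d N =
      (∫ t in e..1, t ^ (d - 1) * (1 - t) ^ (N - d)) / beta d ((N : ℝ) - d + 1) := by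
  have hdN : (d : ℝ) ≤ N := by exact_mod_cast hN
  rw [phiTail, one_sub_regBeta (by exact_mod_cast hd) (by linarith) he]
  simp_rw [betaIntegrand_natCast hd hN]

theorem one_sub_choose_mul_pow_le_phiTail (hd : 1 ≤ d) (hN : d ≤ N) {e : ℝ}
    (he : e ∈ Set.Icc (0 : ℝ) 1) : 1 - N.choose d * e ^ d ≤ phiTail e d N := by
  have hdN : (d : ℝ) ≤ N := by exact_mod_cast hN
  have hd0 : (0 : ℝ) < d := by exact_mod_cast hd
  rw [phiTail, regBeta_eq hd0 (by linarith)]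
  simp_rw [betaIntegrand_natCast hd hN]
  refine sub_le_sub_left ((div_le_iff₀ (beta_natCast_pos hd hN)).2 ?_) _
  have hint : ∫ t in (0 : ℝ)..e, t ^ (d - 1) = e ^ d / d := by
    rw [integral_pow]
    simp [Nat.sub_add_cancel hd, Nat.cast_sub hd, zero_pow (by omega : d ≠ 0)]
  calc ∫ t in (0 : ℝ)..e, t ^ (d - 1) * (1 - t) ^ (N - d) ≤ ∫ t in (0 : ℝ)..e, t ^ (d - 1) := by
        refine intervalIntegral.integral_mono_on he.1
          (Continuous.intervalIntegrable (by fun_prop) _ _)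
          (Continuous.intervalIntegrable (by fun_prop) _ _) fun t ht => ?_
        exact mul_le_of_le_one_right (pow_nonneg ht.1 _)
          (pow_le_one₀ (by linarith [ht.2, he.2]) (by linarith [ht.1]))
    _ = e ^ d / d * (d * beta d ((N : ℝ) - d + 1) * N.choose d) := by
        rw [hint, natCast_mul_beta_mul_choose hd hN, mul_one]
    _ = N.choose d * e ^ d * beta d ((N : ℝ) - d + 1) := by field_simp

theorem integral_pow_mul_one_sub_pow_comp_affine (d N : ℕ) (e : ℝ) :
    ∫ t in e..1, t ^ (d - 1) * (1 - t) ^ (N - d) =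
      ∫ s in (0 : ℝ)..1, (1 - e) ^ (N - d + 1) *
        (((1 - e) * s + e) ^ (d - 1) * (1 - s) ^ (N - d)) := by
  have hsub := intervalIntegral.mul_integral_comp_mul_add (a := 0) (b := 1)
    (f := fun t : ℝ => t ^ (d - 1) * (1 - t) ^ (N - d)) (1 - e) e
  simp only [mul_zero, zero_add, mul_one, sub_add_cancel] at hsub
  rw [← hsub, ← intervalIntegral.integral_const_mul]
  refine intervalIntegral.integral_congr fun s _ => ?_
  rw [show 1 - ((1 - e) * s + e) = (1 - e) * (1 - s) by ring, mul_pow, pow_succ]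
  ring

theorem one_sub_pow_le_phiTail (hd : 1 ≤ d) (hN : d ≤ N) {e : ℝ}
    (he : e ∈ Set.Icc (0 : ℝ) 1) : (1 - e) ^ N ≤ phiTail e d N := by
  rw [phiTail_eq hd hN he, le_div_iff₀ (beta_natCast_pos hd hN),
    integral_pow_mul_one_sub_pow_comp_affine, ← integral_pow_mul_one_sub_pow hd hN,
    ← intervalIntegral.integral_const_mul]
  refine intervalIntegral.integral_mono_on zero_le_one
    (Continuous.intervalIntegrable (by fun_prop) _ _)
    (Continuous.intervalIntegrable (by fun_prop) _ _) fun s hs => ?_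
  have he0 : 0 ≤ e := he.1
  have he1 : 0 ≤ 1 - e := by linarith [he.2]
  have hs0 : 0 ≤ s := hs.1
  have hs1 : 0 ≤ 1 - s := by linarith [hs.2]
  calc (1 - e) ^ N * (s ^ (d - 1) * (1 - s) ^ (N - d))
      = (1 - e) ^ (N - d + 1) * (((1 - e) * s) ^ (d - 1) * (1 - s) ^ (N - d)) := by
        conv_lhs => rw [show N = N - d + 1 + (d - 1) by omega, pow_add]
        rw [mul_pow, show N - d + 1 + (d - 1) - d = N - d by omega]
        ring
    _ ≤ (1 - e) ^ (N - d + 1) * (((1 - e) * s + e) ^ (d - 1) * (1 - s) ^ (N - d)) := by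
        gcongr
        linarith

-- Markov's inequality for the beta distribution of parameters `d` and `N - d + 1`, whose mean
-- is `d / (N + 1)`.
theorem phiTail_le (hd : 1 ≤ d) (hN : d ≤ N) {e : ℝ} (he0 : 0 < e) (he1 : e ≤ 1) :
    phiTail e d N ≤ d / ((N + 1) * e) := by
  have hdN : (d : ℝ) ≤ N := by exact_mod_cast hN
  have hd0 : (0 : ℝ) < d := by exact_mod_cast hd
  have hmean : ∫ t in (0 : ℝ)..1, t * (t ^ (d - 1) * (1 - t) ^ (N - d)) =
      d / (N + 1) * beta d ((N : ℝ) - d + 1) := by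
    have hbeta := beta_add_one_left hd0 (by linarith : 0 < (N : ℝ) - d + 1)
    rw [show (d : ℝ) + (N - d + 1) = N + 1 by ring] at hbeta
    have hint := integral_pow_mul_one_sub_pow (d := d + 1) (N := N + 1) (by omega) (by omega)
    push_cast at hint
    rw [show (N : ℝ) + 1 - (d + 1) + 1 = N - d + 1 by ring, hbeta] at hint
    rw [← hint]
    simp_rw [← mul_assoc, mul_pow_sub_one (by omega : d ≠ 0)]
  have hnonneg : ∀ t ∈ Set.Icc (0 : ℝ) 1, 0 ≤ t ^ (d - 1) * (1 - t) ^ (N - d) := fun t ht =>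
    mul_nonneg (pow_nonneg ht.1 _) (pow_nonneg (by linarith [ht.2]) _)
  rw [phiTail_eq hd hN ⟨he0.le, he1⟩, div_le_iff₀ (beta_natCast_pos hd hN)]
  calc ∫ t in e..1, t ^ (d - 1) * (1 - t) ^ (N - d)
      ≤ ∫ t in e..1, e⁻¹ * (t * (t ^ (d - 1) * (1 - t) ^ (N - d))) := by
        refine intervalIntegral.integral_mono_on he1
          (Continuous.intervalIntegrable (by fun_prop) _ _)
          (Continuous.intervalIntegrable (by fun_prop) _ _) fun t ht => ?_
        rw [← mul_assoc]
        exact le_mul_of_one_le_left (hnonneg t ⟨he0.le.trans ht.1, ht.2⟩)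
          ((one_le_inv_mul₀ he0).2 ht.1)
    _ ≤ ∫ t in (0 : ℝ)..1, e⁻¹ * (t * (t ^ (d - 1) * (1 - t) ^ (N - d))) := by
        refine intervalIntegral.integral_mono_interval he0.le he1 le_rfl ?_
          (Continuous.intervalIntegrable (by fun_prop) _ _)
        filter_upwards [ae_restrict_mem measurableSet_Ioc] with t ht
        exact mul_nonneg (inv_nonneg.2 he0.le)
          (mul_nonneg ht.1.le (hnonneg t (Set.Ioc_subset_Icc_self ht)))
    _ = d / ((N + 1) * e) * beta d ((N : ℝ) - d + 1) := by
        rw [intervalIntegral.integral_const_mul, hmean]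
        field_simp

end PhiTail

section SphereCone

open scoped Pointwise

theorem exists_orthonormalBasis_apply_eq {𝕜 ι E : Type*} [RCLike 𝕜] [NormedAddCommGroup E]
    [InnerProductSpace 𝕜 E] [FiniteDimensional 𝕜 E] [Fintype ι]
    (hcard : Module.finrank 𝕜 E = Fintype.card ι) (i₀ : ι) {u : E} (hu : ‖u‖ = 1) :
    ∃ b : OrthonormalBasis ι 𝕜 E, b i₀ = u := by
  classical
  have horth : Orthonormal 𝕜 (({i₀} : Set ι).domRestrict fun _ => u) := by
    refine orthonormal_iff_ite.2 fun i j => ?_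
    rw [if_pos (Subsingleton.elim i j)]
    exact inner_self_eq_one_of_norm_eq_one hu
  obtain ⟨b, hb⟩ := horth.exists_orthonormalBasis_extension_of_card_eq hcard
  exact ⟨b, hb i₀ rfl⟩

variable {ι : Type*} [Fintype ι] {E : Type*} [NormedAddCommGroup E] [InnerProductSpace ℝ E]

theorem norm_sub_inner_smul_le (b : OrthonormalBasis ι ℝ E) (i₀ : ι) {δ : ℝ} {x : E}
    (hx : ∀ i ≠ i₀, |b.repr x i| ≤ δ) :
    ‖x - inner ℝ (b i₀) x • b i₀‖ ≤ (Fintype.card ι - 1 : ℕ) * δ := by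
  classical
  have hsum : x - inner ℝ (b i₀) x • b i₀ = ∑ i ∈ Finset.univ.erase i₀, b.repr x i • b i := by
    rw [Finset.sum_erase_eq_sub (Finset.mem_univ i₀), b.sum_repr, b.repr_apply_apply]
  calc ‖x - inner ℝ (b i₀) x • b i₀‖
      ≤ ∑ i ∈ Finset.univ.erase i₀, ‖b.repr x i • b i‖ := hsum ▸ norm_sum_le _ _
    _ ≤ ∑ _i ∈ Finset.univ.erase i₀, δ := Finset.sum_le_sum fun i hi => by
        rw [norm_smul, b.norm_eq_one, mul_one]
        exact hx i (Finset.ne_of_mem_erase hi)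
    _ = (Fintype.card ι - 1 : ℕ) * δ := by
        rw [Finset.sum_const, Finset.card_erase_of_mem (Finset.mem_univ i₀), Finset.card_univ,
          nsmul_eq_mul]

variable [DecidableEq ι]

/-- The box of half-width `δ` around the segment from `1 / 4` to `1 / 2` on the axis `i₀`. For
small `δ` it lies in the unit ball and in a narrow circular cone about that axis. -/
def axisBox (i₀ : ι) (δ : ℝ) : Set (ι → ℝ) :=
  Set.univ.pi fun i => if i = i₀ then Set.Ioo (1 / 4) (1 / 2) else Set.Ioo (-δ) δ

omit [Fintype ι] in
theorem measurableSet_axisBox [Finite ι] (i₀ : ι) (δ : ℝ) : MeasurableSet (axisBox i₀ δ) :=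
  MeasurableSet.univ_pi fun i => by split_ifs <;> exact measurableSet_Ioo

theorem volumeReal_axisBox (i₀ : ι) {δ : ℝ} (hδ : 0 ≤ δ) :
    (volume : Measure (ι → ℝ)).real (axisBox i₀ δ) =
      1 / 4 * (2 * δ) ^ (Fintype.card ι - 1) := by
  rw [measureReal_def, axisBox, volume_pi, Measure.pi_pi, ENNReal.toReal_prod,
    ← Finset.mul_prod_erase _ _ (Finset.mem_univ i₀),
    Finset.prod_congr rfl fun i hi => by rw [if_neg (Finset.ne_of_mem_erase hi)],
    Finset.prod_const, Finset.card_erase_of_mem (Finset.mem_univ i₀), Finset.card_univ,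
    if_pos rfl, Real.volume_Ioo, Real.volume_Ioo, ENNReal.toReal_ofReal (by norm_num),
    ENNReal.toReal_ofReal (by linarith), sub_neg_eq_add, ← two_mul]
  norm_num

variable [MeasurableSpace E] [BorelSpace E] [FiniteDimensional ℝ E]

theorem volumeReal_preimage_axisBox (b : OrthonormalBasis ι ℝ E) (i₀ : ι) {δ : ℝ} (hδ : 0 ≤ δ) :
    (volume : Measure E).real {x | WithLp.ofLp (b.repr x) ∈ axisBox i₀ δ} =
      1 / 4 * (2 * δ) ^ (Fintype.card ι - 1) := by
  rw [← volumeReal_axisBox i₀ hδ]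
  exact ((EuclideanSpace.volume_preserving_symm_measurableEquiv_toLp ι).comp
    b.measurePreserving_repr).measureReal_preimage (measurableSet_axisBox i₀ δ).nullMeasurableSet

omit [MeasurableSpace E] [BorelSpace E] [FiniteDimensional ℝ E] in
theorem mem_Ioo_smul_of_mem_axisBox (b : OrthonormalBasis ι ℝ E) (i₀ : ι) {r : ℝ} (hr1 : r ≤ 1)
    {A : Set E} (hA : ∀ x : E, ‖x‖ = 1 → 0 < inner ℝ (b i₀) x →
      ‖x - inner ℝ (b i₀) x • b i₀‖ < r * inner ℝ (b i₀) x → x ∈ A)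
    (hr : 0 < r) {x : E} (hx : WithLp.ofLp (b.repr x) ∈ axisBox i₀ (r / (4 * Fintype.card ι))) :
    x ∈ Set.Ioo (0 : ℝ) 1 • A := by
  have hcard : (0 : ℝ) < Fintype.card ι := by exact_mod_cast Fintype.card_pos_iff.2 ⟨i₀⟩
  have hx0 : inner ℝ (b i₀) x ∈ Set.Ioo (1 / 4 : ℝ) (1 / 2) := by
    simpa [b.repr_apply_apply] using hx i₀ (Set.mem_univ _)
  have hinner : 0 < inner ℝ (b i₀) x := by linarith [hx0.1]
  have hperp : ‖x - inner ℝ (b i₀) x • b i₀‖ ≤ r / 4 := by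
    calc ‖x - inner ℝ (b i₀) x • b i₀‖
        ≤ (Fintype.card ι - 1 : ℕ) * (r / (4 * Fintype.card ι)) := by
          refine norm_sub_inner_smul_le b i₀ fun i hi => ?_
          exact (abs_lt.2 (by simpa only [if_neg hi, Set.mem_Ioo] using hx i (Set.mem_univ _))).le
      _ ≤ Fintype.card ι * (r / (4 * Fintype.card ι)) := by
          gcongr
          exact Nat.sub_le _ _
      _ = r / 4 := by field_simp
  have hnorm : ‖x‖ < 1 := by
    calc ‖x‖ = ‖(x - inner ℝ (b i₀) x • b i₀) + inner ℝ (b i₀) x • b i₀‖ := by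
          rw [sub_add_cancel]
      _ ≤ ‖x - inner ℝ (b i₀) x • b i₀‖ + ‖inner ℝ (b i₀) x • b i₀‖ := norm_add_le _ _
      _ < 1 / 4 + 1 / 2 := by
          rw [norm_smul, b.norm_eq_one, mul_one, Real.norm_of_nonneg hinner.le]
          linarith [hx0.2]
      _ ≤ 1 := by norm_num
  have hpos : 0 < ‖x‖ := norm_pos_iff.2 fun h => by simp [h] at hinner
  have hinv : 0 < ‖x‖⁻¹ := inv_pos.2 hpos
  have hunit : ‖‖x‖⁻¹ • x‖ = 1 := norm_smul_inv_norm (𝕜 := ℝ) (norm_pos_iff.1 hpos)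
  refine ⟨‖x‖, ⟨hpos, hnorm⟩, ‖x‖⁻¹ • x, hA _ hunit ?_ ?_, ?_⟩
  · exact inner_smul_right (b i₀) x ‖x‖⁻¹ ▸ mul_pos hinv hinner
  · rw [inner_smul_right, mul_smul, ← smul_sub, norm_smul, Real.norm_of_nonneg hinv.le,
      mul_left_comm]
    exact mul_lt_mul_of_pos_left (hperp.trans_lt (by nlinarith [hx0.1])) hinv
  · exact smul_inv_smul₀ hpos.ne' x

end SphereCone

section SphereUniform

open scoped Pointwise

variable (n : ℕ)

theorem volume_Ioo_smul_sphere_ne_top {n : ℕ} (A : Set (UnitSphere n)) :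
    (volume : Measure (EuclideanSpace ℝ (Fin n))) (Set.Ioo (0 : ℝ) 1 • ((↑) '' A)) ≠ ⊤ := by
  refine ((measure_mono (t := Metric.ball 0 1) ?_).trans_lt measure_ball_lt_top).ne
  rintro _ ⟨t, ht, _, ⟨x, -, rfl⟩, rfl⟩
  have hx : ‖x.1‖ = 1 := by simp
  simp [norm_smul, hx, abs_of_pos ht.1, ht.2]

variable [NeZero n]

instance isProbabilityMeasure_sphereUniform : IsProbabilityMeasure (sphereUniform n) :=
  cond_isProbabilityMeasure (by
    rw [Ne, Measure.measure_univ_eq_zero]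
    exact Measure.toSphere_ne_zero _)

variable {n}

theorem sphereUniform_real_eq {A : Set (UnitSphere n)} (hA : MeasurableSet A) :
    (sphereUniform n).real A =
      (volume : Measure (EuclideanSpace ℝ (Fin n))).real (Set.Ioo (0 : ℝ) 1 • ((↑) '' A)) /
        (volume : Measure (EuclideanSpace ℝ (Fin n))).real (Metric.ball 0 1) := by
  have hdim : (n : ℝ) ≠ 0 := NeZero.ne _
  rw [sphereUniform, measureReal_def, cond_apply MeasurableSet.univ, Set.univ_inter,
    ENNReal.toReal_mul, ENNReal.toReal_inv, Measure.toSphere_apply_univ,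
    Measure.toSphere_apply' _ hA, ENNReal.toReal_mul, ENNReal.toReal_mul, ← measureReal_def,
    ← measureReal_def, ENNReal.toReal_natCast, finrank_euclideanSpace_fin]
  field_simp

variable (n) in
theorem exists_le_sphereUniform_cone :
    ∃ c : ℝ, 0 < c ∧ ∀ u : EuclideanSpace ℝ (Fin n), ‖u‖ = 1 → ∀ r : ℝ, 0 < r → r ≤ 1 →
      ∀ A : Set (UnitSphere n), MeasurableSet A →
        (∀ x : UnitSphere n, 0 < inner ℝ u x.1 →
          ‖x.1 - inner ℝ u x.1 • u‖ < r * inner ℝ u x.1 → x ∈ A) →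
        c * r ^ (n - 1) ≤ (sphereUniform n).real A := by
  set V : ℝ := (volume : Measure (EuclideanSpace ℝ (Fin n))).real (Metric.ball 0 1)
  have hVpos : 0 < V := ENNReal.toReal_pos (Metric.measure_ball_pos _ _ one_pos).ne'
    measure_ball_lt_top.ne
  have hn : (0 : ℝ) < n := by exact_mod_cast NeZero.pos n
  refine ⟨1 / 4 * (1 / (2 * n)) ^ (n - 1) / V, by positivity, fun u hu r hr hr1 A hA hcone => ?_⟩
  obtain ⟨b, rfl⟩ := exists_orthonormalBasis_apply_eq (𝕜 := ℝ) (E := EuclideanSpace ℝ (Fin n))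
    (by simp) (0 : Fin n) hu
  have hbox := volumeReal_preimage_axisBox b 0 (δ := r / (4 * n)) (by positivity)
  rw [Fintype.card_fin] at hbox
  calc 1 / 4 * (1 / (2 * n)) ^ (n - 1) / V * r ^ (n - 1)
      = (volume : Measure (EuclideanSpace ℝ (Fin n))).real
          {x | WithLp.ofLp (b.repr x) ∈ axisBox 0 (r / (4 * n))} / V := by
        rw [hbox, show 2 * (r / (4 * n)) = 1 / (2 * n) * r by field_simp; norm_num, mul_pow]
        ring
    _ ≤ (sphereUniform n).real A := by
        rw [sphereUniform_real_eq hA]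
        refine div_le_div_of_nonneg_right (measureReal_mono (fun x hx => ?_)
          (volume_Ioo_smul_sphere_ne_top A)) hVpos.le
        refine mem_Ioo_smul_of_mem_axisBox b 0 hr1 (fun y hy hpos hlt => ?_) hr
          (by rwa [Fintype.card_fin])
        exact ⟨⟨y, by simpa using hy⟩, hcone _ hpos hlt, rfl⟩

end SphereUniform

section QuadraticForms

variable {ι κ : Type*} [Fintype ι] [Fintype κ]

theorem dotProduct_self_eq_norm_sq (x : ι → ℝ) : x ⬝ᵥ x = ‖WithLp.toLp 2 x‖ ^ 2 := by
  rw [EuclideanSpace.real_norm_sq_eq]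
  simp [dotProduct, sq]

theorem exists_dotProduct_map_le (L : (ι → ℝ) →ₗ[ℝ] (κ → ℝ)) :
    ∃ K : ℝ, 0 ≤ K ∧ ∀ x, L x ⬝ᵥ L x ≤ K * (x ⬝ᵥ x) := by
  let L₂ : EuclideanSpace ℝ ι →L[ℝ] EuclideanSpace ℝ κ := LinearMap.toContinuousLinearMap
    ((WithLp.linearEquiv 2 ℝ (κ → ℝ)).symm.toLinearMap ∘ₗ L ∘ₗ
      (WithLp.linearEquiv 2 ℝ (ι → ℝ)).toLinearMap)
  refine ⟨‖L₂‖ ^ 2, by positivity, fun x => ?_⟩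
  rw [dotProduct_self_eq_norm_sq, dotProduct_self_eq_norm_sq, ← mul_pow]
  exact pow_le_pow_left₀ (norm_nonneg _) (L₂.le_opNorm (WithLp.toLp 2 x)) 2

theorem exists_dotProduct_le_map (L : (ι → ℝ) →ₗ[ℝ] (κ → ℝ)) (hL : ∀ x, L x = 0 → x = 0) :
    ∃ K : ℝ, 0 ≤ K ∧ ∀ x, x ⬝ᵥ x ≤ K * (L x ⬝ᵥ L x) := by
  obtain ⟨g, hg⟩ := L.exists_leftInverse_of_injective (LinearMap.ker_eq_bot'.2 hL)
  obtain ⟨K, hK, h⟩ := exists_dotProduct_map_le g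
  refine ⟨K, hK, fun x => ?_⟩
  have hgL : g (L x) = x := LinearMap.congr_fun hg x
  simpa only [hgL] using h (L x)

theorem dotProduct_mulVec_le_of_posSemidef_sub {A B : Matrix ι ι ℝ} (h : (B - A).PosSemidef)
    (x : ι → ℝ) : x ⬝ᵥ (A *ᵥ x) ≤ x ⬝ᵥ (B *ᵥ x) := by
  have hx := h.dotProduct_mulVec_nonneg x
  rwa [star_trivial, sub_mulVec, dotProduct_sub, sub_nonneg] at hx

omit [Fintype ι] in
theorem posDef_of_sub_one [DecidableEq ι] {P : Matrix ι ι ℝ} (h : (P - 1).PosSemidef) :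
    P.PosDef := by
  simpa using PosDef.posSemidef_add h PosDef.one

omit [Fintype ι] in
theorem posSemidef_smul_one_sub_one [DecidableEq ι] {c : ℝ} (hc : 1 ≤ c) :
    (c • (1 : Matrix ι ι ℝ) - 1).PosSemidef := by
  simpa only [sub_smul, one_smul] using
    (PosSemidef.one (n := ι) (R := ℝ)).smul (sub_nonneg.2 hc)

-- The difference `ρ Q - R` is positive semidefinite and its form vanishes at `u`, hence `u` lies
-- in its kernel: the cross terms of `ρ Q` and `R` agree.
theorem mul_sub_le_dotProduct_mulVec_add {Q R : Matrix ι ι ℝ} {ρ : ℝ} {u : ι → ℝ}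
    (hQ : Q.IsHermitian) (hR : R.PosSemidef) (hle : ∀ x, x ⬝ᵥ (R *ᵥ x) ≤ ρ * (x ⬝ᵥ (Q *ᵥ x)))
    (hu : u ⬝ᵥ (R *ᵥ u) = ρ * (u ⬝ᵥ (Q *ᵥ u))) (s : ℝ) (w : ι → ℝ) :
    ρ * ((s • u + w) ⬝ᵥ (Q *ᵥ (s • u + w)) - w ⬝ᵥ (Q *ᵥ w)) ≤
      (s • u + w) ⬝ᵥ (R *ᵥ (s • u + w)) := by
  have hform : ∀ x, x ⬝ᵥ ((ρ • Q - R) *ᵥ x) = ρ * (x ⬝ᵥ (Q *ᵥ x)) - x ⬝ᵥ (R *ᵥ x) := fun x => by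
    simp only [sub_mulVec, smul_mulVec, dotProduct_sub, dotProduct_smul, smul_eq_mul]
  have hpsd : (ρ • Q - R).PosSemidef :=
    PosSemidef.of_dotProduct_mulVec_nonneg ((hQ.smul (IsSelfAdjoint.all ρ)).sub hR.1) fun x => by
      rw [star_trivial, hform]
      linarith [hle x]
  have hker : R *ᵥ u = ρ • (Q *ᵥ u) := by
    have hnull : (ρ • Q - R) *ᵥ u = 0 :=
      (hpsd.dotProduct_mulVec_zero_iff u).1 (by rw [star_trivial, hform, hu, sub_self])
    rw [sub_mulVec, smul_mulVec, sub_eq_zero] at hnull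
    exact hnull.symm
  have hsymm : ∀ A : Matrix ι ι ℝ, A.IsHermitian → u ⬝ᵥ (A *ᵥ w) = w ⬝ᵥ (A *ᵥ u) :=
    fun A hA => by
      rw [dotProduct_mulVec, ← mulVec_transpose, ← conjTranspose_eq_transpose_of_trivial, hA.eq,
        dotProduct_comm]
  have hRw : 0 ≤ w ⬝ᵥ (R *ᵥ w) := by simpa using hR.dotProduct_mulVec_nonneg w
  simp only [mulVec_add, mulVec_smul, dotProduct_add, add_dotProduct, smul_dotProduct,
    dotProduct_smul, smul_eq_mul, hsymm R hR.1, hsymm Q hQ, hker]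
  linarith

end QuadraticForms

namespace SLS

variable {n p M : ℕ} (S : SLS n p M)

section Windows

variable {T T' : ℕ} {σ : Fin T → Fin M} {σ' : Fin T' → Fin M} {l k : ℕ}

theorem transition_add (hT : l + T' ≤ T) (hσ : ∀ i : Fin T', σ' i = σ ⟨l + i, by omega⟩) {t : ℕ}
    (ht : t ≤ T') : S.transition σ (l + t) = S.transition σ' t * S.transition σ l := by
  induction t with
  | zero => simp [transition]
  | succ t ih =>
    rw [← add_assoc, transition, transition, dif_pos (by omega : l + t < T),
      dif_pos (by omega : t < T'), ih (by omega), hσ, Matrix.mul_assoc]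

theorem window_add (hT : l + T' ≤ T) (hσ : ∀ i : Fin T', σ' i = σ ⟨l + i, by omega⟩)
    (x : Fin n → ℝ) {j : ℕ} (hjk : j + k ≤ T') :
    S.window σ x (l + j) k = S.window σ' (S.transition σ l *ᵥ x) j k := by
  ext ⟨i, a⟩
  have hi : j + (i : ℕ) < T' := by omega
  have hi' : l + (j + (i : ℕ)) < T := by omega
  simp only [window, output, add_assoc, dif_pos hi, dif_pos hi', hσ ⟨j + i, hi⟩, mulVec_mulVec,
    S.transition_add hT hσ hi.le]

theorem window_castLE (hk : k ≤ T') (hT : T' ≤ T) (x : Fin n → ℝ) :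
    S.window (fun i => σ (Fin.castLE hT i)) x 0 k = S.window σ x 0 k := by
  have h := S.window_add (σ := σ) (σ' := fun i : Fin T' => σ (Fin.castLE hT i)) (l := 0) (j := 0)
    (by omega) (fun i => congrArg σ (Fin.ext (zero_add _).symm)) x (by omega : 0 + k ≤ T')
  simpa only [transition, one_mulVec, add_zero] using h.symm

variable (σ)

/-- The window of outputs as a linear function of the initial state. -/
def windowMap (l k : ℕ) : (Fin n → ℝ) →ₗ[ℝ] (Fin k × Fin p → ℝ) where
  toFun x := S.window σ x l k
  map_add' x y := by
    ext ij
    simp only [window, output, Pi.add_apply]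
    split_ifs <;> simp [mulVec_add]
  map_smul' c x := by
    ext ij
    simp only [window, output, Pi.smul_apply, RingHom.id_apply]
    split_ifs <;> simp [mulVec_smul]

theorem continuous_window (T l k : ℕ) :
    Continuous fun δ : Datum n M T => S.window δ.2 (WithLp.ofLp δ.1.1) l k := by
  refine continuous_prod_of_discrete_right.2 fun σ => ?_
  exact (S.windowMap σ l k).continuous_of_finiteDimensional.comp (by fun_prop)

end Windows

section Energy

variable {T k : ℕ} {P Q : Matrix (Fin k × Fin p) (Fin k × Fin p) ℝ} (σ : Fin T → Fin M) (l : ℕ)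
  (x : Fin n → ℝ)

/-- The quadratic Lyapunov function `wᵀ P w` of the output window `w` starting at time `l`.
The inequality `(*)` compares it at the times `T - k` and `0`. -/
def energy (P : Matrix (Fin k × Fin p) (Fin k × Fin p) ℝ) {T : ℕ} (σ : Fin T → Fin M) (l : ℕ)
    (x : Fin n → ℝ) : ℝ :=
  S.window σ x l k ⬝ᵥ (P *ᵥ S.window σ x l k)

theorem decrease_iff {γ : ℝ} : S.Decrease k γ P σ x ↔
    S.energy P σ (T - k) x ≤ γ ^ (2 * (T - k)) * S.energy P σ 0 x := Iff.rfl

theorem energy_zero : S.energy P σ l 0 = 0 := by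
  have hw : S.window σ 0 l k = 0 := (S.windowMap σ l k).map_zero
  rw [energy, hw, zero_dotProduct]

theorem energy_smul (c : ℝ) : S.energy P σ l (c • x) = c ^ 2 * S.energy P σ l x := by
  have hw : S.window σ (c • x) l k = c • S.window σ x l k := (S.windowMap σ l k).map_smul c x
  rw [energy, hw, mulVec_smul, dotProduct_smul, smul_dotProduct, smul_eq_mul, smul_eq_mul,
    ← mul_assoc, ← sq, energy]

theorem energy_matrix_add : S.energy (P + Q) σ l x = S.energy P σ l x + S.energy Q σ l x := by
  rw [energy, add_mulVec, dotProduct_add, energy, energy]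

theorem energy_matrix_smul (c : ℝ) : S.energy (c • P) σ l x = c * S.energy P σ l x := by
  rw [energy, smul_mulVec, dotProduct_smul, smul_eq_mul, energy]

variable {σ l x}

theorem energy_nonneg (hP : P.PosSemidef) : 0 ≤ S.energy P σ l x := by
  simpa [energy] using hP.dotProduct_mulVec_nonneg (S.window σ x l k)

theorem energy_mono (h : (Q - P).PosSemidef) : S.energy P σ l x ≤ S.energy Q σ l x :=
  dotProduct_mulVec_le_of_posSemidef_sub h _

theorem continuous_energy {Z : Type*} [TopologicalSpace Z]
    {P : Z → Matrix (Fin k × Fin p) (Fin k × Fin p) ℝ} {δ : Z → Datum n M T} (hP : Continuous P)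
    (hδ : Continuous δ) (l : ℕ) :
    Continuous fun z => S.energy (P z) (δ z).2 l (WithLp.ofLp (δ z).1.1) := by
  have hw := (S.continuous_window T l k).comp hδ
  exact hw.dotProduct (hP.matrix_mulVec hw)

/-- The matrix of the quadratic form `x ↦ S.energy P σ l x`. -/
noncomputable def energyForm (P : Matrix (Fin k × Fin p) (Fin k × Fin p) ℝ) {T : ℕ}
    (σ : Fin T → Fin M) (l : ℕ) : Matrix (Fin n) (Fin n) ℝ :=
  (LinearMap.toMatrix' (S.windowMap σ l k))ᵀ * P * LinearMap.toMatrix' (S.windowMap σ l k)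

theorem dotProduct_energyForm_mulVec :
    x ⬝ᵥ (S.energyForm P σ l *ᵥ x) = S.energy P σ l x := by
  have hw : LinearMap.toMatrix' (S.windowMap σ l k) *ᵥ x = S.window σ x l k :=
    LinearMap.toMatrix'_mulVec _ _
  rw [energyForm, ← mulVec_mulVec, ← mulVec_mulVec, hw, dotProduct_mulVec, vecMul_transpose, hw,
    energy]

theorem energyForm_posSemidef (hP : P.PosSemidef) : (S.energyForm P σ l).PosSemidef := by
  have h := hP.conjTranspose_mul_mul_same (LinearMap.toMatrix' (S.windowMap σ l k))
  rwa [conjTranspose_eq_transpose_of_trivial] at h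

theorem mul_sub_le_energy_add (hP : P.PosSemidef) {l' : ℕ} {ρ : ℝ} {u : Fin n → ℝ}
    (hle : ∀ x, S.energy P σ l' x ≤ ρ * S.energy P σ l x)
    (hu : S.energy P σ l' u = ρ * S.energy P σ l u) (s : ℝ) (w : Fin n → ℝ) :
    ρ * (S.energy P σ l (s • u + w) - S.energy P σ l w) ≤ S.energy P σ l' (s • u + w) := by
  simp only [← dotProduct_energyForm_mulVec] at hle hu ⊢
  exact mul_sub_le_dotProduct_mulVec_add (S.energyForm_posSemidef hP).1
    (S.energyForm_posSemidef hP) hle hu s w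

theorem exists_energy_one_le (k T l : ℕ) :
    ∃ K : ℝ, 0 ≤ K ∧ ∀ (σ : Fin T → Fin M) (x : Fin n → ℝ),
      S.energy (k := k) 1 σ l x ≤ K * (x ⬝ᵥ x) := by
  choose K hK0 hK using fun σ : Fin T → Fin M => exists_dotProduct_map_le (S.windowMap σ l k)
  refine ⟨∑ σ, K σ, Finset.sum_nonneg fun σ _ => hK0 σ, fun σ x => ?_⟩
  rw [energy, one_mulVec]
  exact (hK σ x).trans (mul_le_mul_of_nonneg_right
    (Finset.single_le_sum (fun σ _ => hK0 σ) (Finset.mem_univ σ)) (dotProduct_self_star_nonneg x))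

end Energy

section Observability

variable {k : ℕ} (hk : S.pathwiseIndex ≤ (k : ℕ∞))

include hk

theorem exists_le_forall_observable : ∃ k' ≤ k, ∀ σ : Fin k' → Fin M, S.Observable σ := by
  have hlt : S.pathwiseIndex < ((k + 1 : ℕ) : ℕ∞) :=
    hk.trans_lt (by exact_mod_cast Nat.lt_succ_self k)
  obtain ⟨k', hlt⟩ := iInf_lt_iff.1 hlt
  obtain ⟨hobs, hk'⟩ := iInf_lt_iff.1 hlt
  exact ⟨k', Nat.lt_succ_iff.1 (by exact_mod_cast hk'), hobs⟩

theorem eq_zero_of_window_eq_zero {T : ℕ} (hT : k ≤ T) {σ : Fin T → Fin M} {x : Fin n → ℝ}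
    (hx : S.window σ x 0 k = 0) : x = 0 := by
  obtain ⟨k', hk', hobs⟩ := S.exists_le_forall_observable hk
  refine hobs (fun i => σ (Fin.castLE (hk'.trans hT) i)) x ?_
  rw [S.window_castLE le_rfl]
  ext ⟨i, a⟩
  exact congrFun hx (Fin.castLE hk' i, a)

theorem energy_pos {T : ℕ} (hT : k ≤ T) {P : Matrix (Fin k × Fin p) (Fin k × Fin p) ℝ}
    (hP : P.PosDef) (σ : Fin T → Fin M) {x : Fin n → ℝ} (hx : x ≠ 0) : 0 < S.energy P σ 0 x := by
  simpa [energy] using hP.dotProduct_mulVec_pos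
    fun hw => hx (S.eq_zero_of_window_eq_zero hk hT (σ := σ) hw)

theorem exists_energy_one_bounds :
    ∃ K : ℝ, 1 ≤ K ∧ ∀ (T : ℕ) (σ : Fin T → Fin M) (x : Fin n → ℝ), k ≤ T →
      x ⬝ᵥ x ≤ K * S.energy (k := k) 1 σ 0 x ∧ S.energy (k := k) 1 σ 0 x ≤ K * (x ⬝ᵥ x) := by
  choose K hK0 hK using fun σ : Fin k → Fin M => exists_dotProduct_le_map (S.windowMap σ 0 k)
    fun x hx => S.eq_zero_of_window_eq_zero hk le_rfl hx
  obtain ⟨K', hK'0, hK'⟩ := S.exists_energy_one_le k k 0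
  have hsum : 0 ≤ ∑ σ, K σ := Finset.sum_nonneg fun σ _ => hK0 σ
  refine ⟨∑ σ, K σ + K' + 1, by linarith, fun T σ x hT => ?_⟩
  set σ' : Fin k → Fin M := fun i => σ (Fin.castLE hT i)
  have henergy : S.energy (k := k) 1 σ 0 x = S.energy (k := k) 1 σ' 0 x := by
    rw [energy, energy, S.window_castLE le_rfl]
  have hlower : x ⬝ᵥ x ≤ K σ' * S.energy (k := k) 1 σ' 0 x := by
    rw [energy, one_mulVec]
    exact hK σ' x
  have hK_le : K σ' ≤ ∑ σ, K σ := Finset.single_le_sum (fun σ _ => hK0 σ) (Finset.mem_univ σ')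
  rw [henergy]
  exact ⟨hlower.trans (mul_le_mul_of_nonneg_right (by linarith)
      (S.energy_nonneg PosSemidef.one)),
    (hK' σ' x).trans (mul_le_mul_of_nonneg_right (by linarith) (dotProduct_self_star_nonneg x))⟩

end Observability

section Feasibility

variable {k T : ℕ} {lam γ : ℝ} {P : Matrix (Fin k × Fin p) (Fin k × Fin p) ℝ}

theorem Decrease.mono {γ' : ℝ} (hγ : 0 ≤ γ) (hγ' : γ ≤ γ') (hP : P.PosSemidef)
    {σ : Fin T → Fin M} {x : Fin n → ℝ} (h : S.Decrease k γ P σ x) : S.Decrease k γ' P σ x :=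
  h.trans (mul_le_mul_of_nonneg_right (pow_le_pow_left₀ hγ hγ' _) (S.energy_nonneg hP))

theorem gammaRobust_le (h : S.RobustFeasible k T γ P) : S.gammaRobust k T ≤ γ :=
  csInf_le ⟨0, fun _ ⟨_, h⟩ => h.1⟩ ⟨P, h⟩

theorem gammaRobust_nonneg : 0 ≤ S.gammaRobust k T := Real.sInf_nonneg fun _ ⟨_, h⟩ => h.1

theorem gammaStar_nonneg {N : ℕ} (ω : Fin N → Datum n M T) : 0 ≤ S.gammaStar k T lam ω :=
  Real.sInf_nonneg fun _ ⟨_, h⟩ => h.1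

variable (hk : S.pathwiseIndex ≤ (k : ℕ∞)) (hT : k < T)

include hk hT

theorem exists_robustFeasible_one : ∃ γ : ℝ, S.RobustFeasible k T γ 1 := by
  obtain ⟨K, hK1, hK⟩ := S.exists_energy_one_bounds hk
  obtain ⟨K', hK'0, hK'⟩ := S.exists_energy_one_le k T (T - k)
  have hγ : 1 ≤ K' * K + 1 := by nlinarith
  refine ⟨K' * K + 1, by linarith, by simpa using PosSemidef.zero, fun σ x => ?_⟩
  have hv : 0 ≤ S.energy (k := k) 1 σ 0 x := S.energy_nonneg PosSemidef.one
  calc S.energy 1 σ (T - k) x ≤ K' * (x ⬝ᵥ x) := hK' σ x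
    _ ≤ K' * (K * S.energy (k := k) 1 σ 0 x) := by
        gcongr
        exact (hK T σ x hT.le).1
    _ ≤ (K' * K + 1) ^ 1 * S.energy 1 σ 0 x := by linarith
    _ ≤ (K' * K + 1) ^ (2 * (T - k)) * S.energy 1 σ 0 x := by
        gcongr
        omega

theorem exists_robustFeasible_of_gammaRobust_lt (h : S.gammaRobust k T < γ) :
    ∃ γ' P, γ' < γ ∧ S.RobustFeasible k T γ' P := by
  obtain ⟨γ₀, h₀⟩ := S.exists_robustFeasible_one hk hT
  obtain ⟨γ', ⟨P, hP⟩, hlt⟩ :=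
    exists_lt_of_csInf_lt (s := {γ : ℝ | ∃ P, S.RobustFeasible k T γ P}) ⟨γ₀, 1, h₀⟩ h
  exact ⟨γ', P, hlt, hP⟩

theorem gammaStar_lt_iff (hlam : 1 ≤ lam) {N : ℕ} (ω : Fin N → Datum n M T) :
    S.gammaStar k T lam ω < γ ↔ ∃ γ' P, γ' < γ ∧ S.ScenarioFeasible k T lam ω γ' P := by
  obtain ⟨γ₀, hγ₀, hone, hdec⟩ := S.exists_robustFeasible_one hk hT
  have hbdd : BddBelow {γ | ∃ P, S.ScenarioFeasible k T lam ω γ P} := ⟨0, fun _ ⟨_, h⟩ => h.1⟩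
  rw [gammaStar, csInf_lt_iff hbdd
    ⟨γ₀, 1, hγ₀, hone, posSemidef_smul_one_sub_one hlam, fun i => hdec _ _⟩]
  exact ⟨fun ⟨γ', ⟨P, hP⟩, hlt⟩ => ⟨γ', P, hlt, hP⟩, fun ⟨γ', P, hlt, hP⟩ => ⟨γ', ⟨P, hP⟩, hlt⟩⟩

end Feasibility

end SLS

section DatumLaw

variable (n M T : ℕ) [NeZero n] [NeZero M]

instance isProbabilityMeasure_datumLaw : IsProbabilityMeasure (datumLaw n M T) := by
  have hmode : IsProbabilityMeasure (uniformOn (Set.univ : Set (Fin M))) :=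
    isProbabilityMeasure_uniformOn Set.finite_univ Set.univ_nonempty
  rw [datumLaw]
  infer_instance

instance isProbabilityMeasure_sampleLaw (N : ℕ) : IsProbabilityMeasure (sampleLaw n M T N) := by
  rw [sampleLaw]
  infer_instance

variable {n M T}

omit [NeZero n] in
theorem datumLaw_real_prod_singleton (A : Set (UnitSphere n)) (σ : Fin T → Fin M) :
    (datumLaw n M T).real (A ×ˢ {σ}) = (sphereUniform n).real A / (M : ℝ) ^ T := by
  have : IsProbabilityMeasure (uniformOn (Set.univ : Set (Fin M))) :=
    isProbabilityMeasure_uniformOn Set.finite_univ Set.univ_nonempty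
  rw [datumLaw, measureReal_prod_prod, measureReal_def (s := {σ}), Measure.pi_singleton]
  simp [uniformOn_univ, div_eq_mul_inv]

end DatumLaw

namespace SLS

variable {n p M : ℕ} (S : SLS n p M)

section MaximalGrowth

variable {k T : ℕ} {P : Matrix (Fin k × Fin p) (Fin k × Fin p) ℝ}

theorem energy_le_of_forall_sphere {ρ : ℝ} {σ : Fin T → Fin M} {l l' : ℕ}
    (h : ∀ u : UnitSphere n,
      S.energy P σ l (WithLp.ofLp u.1) ≤ ρ * S.energy P σ l' (WithLp.ofLp u.1))
    (x : Fin n → ℝ) : S.energy P σ l x ≤ ρ * S.energy P σ l' x := by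
  rcases eq_or_ne x 0 with rfl | hx
  · simp only [energy_zero, mul_zero, le_refl]
  · have hr : ‖WithLp.toLp 2 x‖ ≠ 0 := norm_ne_zero_iff.2 (by simpa using hx)
    let u : UnitSphere n := ⟨‖WithLp.toLp 2 x‖⁻¹ • WithLp.toLp 2 x, by simp [norm_smul, hr]⟩
    have hxu : x = ‖WithLp.toLp 2 x‖ • WithLp.ofLp u.1 := by simp [u, smul_smul, hr]
    rw [hxu, energy_smul, energy_smul, mul_left_comm]
    exact mul_le_mul_of_nonneg_left (h u) (sq_nonneg _)

theorem gammaRobust_pow_le (hT : k < T) (hP : (P - 1).PosSemidef) {ρ : ℝ} (hρ : 0 ≤ ρ)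
    (hle : ∀ (σ : Fin T → Fin M) (x : Fin n → ℝ),
      S.energy P σ (T - k) x ≤ ρ * S.energy P σ 0 x) :
    S.gammaRobust k T ^ (2 * (T - k)) ≤ ρ := by
  have hexp : 2 * (T - k) ≠ 0 := by omega
  have hroot : (ρ ^ ((2 * (T - k) : ℕ) : ℝ)⁻¹) ^ (2 * (T - k)) = ρ :=
    Real.rpow_inv_natCast_pow hρ hexp
  have hfeas : S.RobustFeasible k T (ρ ^ ((2 * (T - k) : ℕ) : ℝ)⁻¹) P :=
    ⟨Real.rpow_nonneg hρ _, hP, fun σ x => (S.decrease_iff σ x).2 (hroot.symm ▸ hle σ x)⟩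
  exact (pow_le_pow_left₀ S.gammaRobust_nonneg (S.gammaRobust_le hfeas) _).trans_eq hroot

variable [NeZero n] [NeZero M]

theorem exists_maximal_growth (hk : S.pathwiseIndex ≤ (k : ℕ∞)) (hT : k < T)
    (hP : (P - 1).PosSemidef) :
    ∃ (ρ : ℝ) (σ₀ : Fin T → Fin M) (u : EuclideanSpace ℝ (Fin n)), ‖u‖ = 1 ∧
      S.gammaRobust k T ^ (2 * (T - k)) ≤ ρ ∧
      S.energy P σ₀ (T - k) u.ofLp = ρ * S.energy P σ₀ 0 u.ofLp ∧
      ∀ (σ : Fin T → Fin M) (x : Fin n → ℝ),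
        S.energy P σ (T - k) x ≤ ρ * S.energy P σ 0 x := by
  have hPd : P.PosDef := posDef_of_sub_one hP
  have hpos : ∀ δ : Datum n M T, 0 < S.energy P δ.2 0 (WithLp.ofLp δ.1.1) := fun δ =>
    S.energy_pos hk hT.le hPd δ.2 fun h => ne_zero_of_mem_unit_sphere δ.1 (by simpa using h)
  have hsphere : Nonempty (UnitSphere n) :=
    (NormedSpace.sphere_nonempty.2 zero_le_one).to_subtype
  have hcont : Continuous fun δ : Datum n M T =>
      S.energy P δ.2 (T - k) (WithLp.ofLp δ.1.1) / S.energy P δ.2 0 (WithLp.ofLp δ.1.1) :=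
    (S.continuous_energy continuous_const continuous_id (T - k)).div
      (S.continuous_energy continuous_const continuous_id 0) fun δ => (hpos δ).ne'
  obtain ⟨δ₀, hmax⟩ : ∃ δ₀ : Datum n M T, ∀ δ : Datum n M T,
      S.energy P δ.2 (T - k) (WithLp.ofLp δ.1.1) / S.energy P δ.2 0 (WithLp.ofLp δ.1.1) ≤
        S.energy P δ₀.2 (T - k) (WithLp.ofLp δ₀.1.1) / S.energy P δ₀.2 0 (WithLp.ofLp δ₀.1.1) := by
    simpa [IsMaxOn, IsMaxFilter] using
      isCompact_univ.exists_isMaxOn Set.univ_nonempty hcont.continuousOn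
  obtain ⟨ρ, hρ⟩ : ∃ ρ, ρ = S.energy P δ₀.2 (T - k) (WithLp.ofLp δ₀.1.1) /
    S.energy P δ₀.2 0 (WithLp.ofLp δ₀.1.1) := ⟨_, rfl⟩
  have hle : ∀ (σ : Fin T → Fin M) (x : Fin n → ℝ),
      S.energy P σ (T - k) x ≤ ρ * S.energy P σ 0 x := fun σ =>
    S.energy_le_of_forall_sphere fun y =>
      (div_le_iff₀ (hpos (y, σ))).1 (hρ ▸ hmax (y, σ))
  have hρ0 : 0 ≤ ρ := hρ ▸ div_nonneg (S.energy_nonneg hPd.posSemidef) (hpos δ₀).le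
  exact ⟨ρ, δ₀.2, δ₀.1.1, norm_eq_of_mem_sphere δ₀.1, S.gammaRobust_pow_le hT hP hρ0 hle,
    (eq_div_iff (hpos δ₀).ne').1 hρ |>.symm, hle⟩

end MaximalGrowth

section Violation

variable {k T : ℕ} {P : Matrix (Fin k × Fin p) (Fin k × Fin p) ℝ} {γ : ℝ}

theorem isClosed_setOf_decrease {Z : Type*} [TopologicalSpace Z]
    {P : Z → Matrix (Fin k × Fin p) (Fin k × Fin p) ℝ} {δ : Z → Datum n M T} (hP : Continuous P)
    (hδ : Continuous δ) (γ : ℝ) :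
    IsClosed {z | S.Decrease k γ (P z) (δ z).2 (WithLp.ofLp (δ z).1.1)} :=
  isClosed_le (S.continuous_energy hP hδ (T - k))
    (continuous_const.mul (S.continuous_energy hP hδ 0))

theorem not_decrease_of_energy_lt {σ : Fin T → Fin M} {ρ h s : ℝ} {u w : Fin n → ℝ}
    (hP : P.PosSemidef) (hρ : 0 < ρ) (hγ : γ ^ (2 * (T - k)) ≤ ρ * (1 - h))
    (hle : ∀ x, S.energy P σ (T - k) x ≤ ρ * S.energy P σ 0 x)
    (hu : S.energy P σ (T - k) u = ρ * S.energy P σ 0 u)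
    (hw : S.energy P σ 0 w < h * S.energy P σ 0 (s • u + w)) :
    ¬ S.Decrease k γ P σ (s • u + w) := by
  rw [decrease_iff, not_le]
  calc γ ^ (2 * (T - k)) * S.energy P σ 0 (s • u + w)
      ≤ ρ * (1 - h) * S.energy P σ 0 (s • u + w) :=
        mul_le_mul_of_nonneg_right hγ (S.energy_nonneg hP)
    _ = ρ * (S.energy P σ 0 (s • u + w) - h * S.energy P σ 0 (s • u + w)) := by ring
    _ < ρ * (S.energy P σ 0 (s • u + w) - S.energy P σ 0 w) :=
        mul_lt_mul_of_pos_left (by linarith) hρ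
    _ ≤ S.energy P σ (T - k) (s • u + w) := S.mul_sub_le_energy_add hP hle hu s w

theorem energy_lt_mul_energy {σ : Fin T → Fin M} {K lam h : ℝ} {x w : Fin n → ℝ}
    (hP : (P - 1).PosSemidef) (hPlam : (lam • 1 - P).PosSemidef) (hK : 0 < K) (hlam : 0 < lam)
    (hh : 0 < h) (hx : x ⬝ᵥ x ≤ K * S.energy (k := k) 1 σ 0 x)
    (hw : S.energy (k := k) 1 σ 0 w ≤ K * (w ⬝ᵥ w))
    (hwx : w ⬝ᵥ w < h / (lam * K ^ 2) * (x ⬝ᵥ x)) :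
    S.energy P σ 0 w < h * S.energy P σ 0 x := by
  calc S.energy P σ 0 w ≤ S.energy (lam • 1) σ 0 w := S.energy_mono hPlam
    _ = lam * S.energy 1 σ 0 w := S.energy_matrix_smul σ 0 w lam
    _ ≤ lam * (K * (w ⬝ᵥ w)) := by gcongr
    _ < lam * (K * (h / (lam * K ^ 2) * (x ⬝ᵥ x))) := by gcongr
    _ = h * ((x ⬝ᵥ x) / K) := by field_simp
    _ ≤ h * S.energy 1 σ 0 x := by
        gcongr
        rwa [div_le_iff₀' hK]
    _ ≤ h * S.energy P σ 0 x := by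
        gcongr
        exact S.energy_mono hP

variable [NeZero n] [NeZero M]

theorem exists_le_datumLaw_not_decrease (hk : S.pathwiseIndex ≤ (k : ℕ∞)) :
    ∃ c : ℝ, 0 < c ∧ ∀ (T : ℕ) (lam h γ : ℝ), k < T → 1 ≤ lam → h ∈ Set.Ioo (0 : ℝ) 1 →
      0 < S.gammaRobust k T → γ ^ (2 * (T - k)) ≤ S.gammaRobust k T ^ (2 * (T - k)) * (1 - h) →
      ∀ P : Matrix (Fin k × Fin p) (Fin k × Fin p) ℝ, (P - 1).PosSemidef →
        (lam • 1 - P).PosSemidef →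
        c * √(h / lam) ^ (n - 1) / (M : ℝ) ^ T ≤
          (datumLaw n M T).real {δ | ¬ S.Decrease k γ P δ.2 (WithLp.ofLp δ.1.1)} := by
  obtain ⟨K, hK1, hK⟩ := S.exists_energy_one_bounds hk
  obtain ⟨c, hc, hcone⟩ := exists_le_sphereUniform_cone n
  have hK0 : 0 < K := by linarith
  refine ⟨c * (1 / K) ^ (n - 1), by positivity,
    fun T lam h γ hT hlam ⟨hh0, hh1⟩ hγ₀ hγ P hP hPlam => ?_⟩
  obtain ⟨ρ, σ₀, u, hu, hρ, hmax, hle⟩ := S.exists_maximal_growth hk hT hP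
  have hlam0 : 0 < lam := by linarith
  have hρ0 : 0 < ρ := (pow_pos hγ₀ _).trans_le hρ
  set r : ℝ := √(h / lam) * (1 / K) with hr
  have hr0 : 0 < r := by positivity
  have hr1 : r ≤ 1 := mul_le_one₀ (Real.sqrt_le_one.2 ((div_le_one hlam0).2 (by linarith)))
    (by positivity) ((div_le_one hK0).2 hK1)
  have hr2 : r ^ 2 = h / (lam * K ^ 2) := by
    rw [hr, mul_pow, Real.sq_sqrt (by positivity)]
    field_simp
  set A : Set (UnitSphere n) := {x | ¬ S.Decrease k γ P σ₀ (WithLp.ofLp x.1)}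
  have hA : MeasurableSet A := (S.isClosed_setOf_decrease continuous_const
    (continuous_id.prodMk continuous_const) γ).measurableSet.compl
  have hbound := hcone u hu r hr0 hr1 A hA fun x hs hw => by
    set s : ℝ := inner ℝ u x.1
    have hx : WithLp.ofLp x.1 = s • WithLp.ofLp u + WithLp.ofLp (x.1 - s • u) := by simp
    have hx1 : ‖x.1‖ = 1 := by simp
    have hs1 : s ≤ 1 := by simpa [hu] using real_inner_le_norm u x.1
    rw [Set.mem_ofPred_eq, hx]
    refine S.not_decrease_of_energy_lt (posDef_of_sub_one hP).posSemidef hρ0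
      (hγ.trans (mul_le_mul_of_nonneg_right hρ (by linarith))) (hle σ₀) hmax ?_
    rw [← hx]
    refine S.energy_lt_mul_energy hP hPlam hK0 hlam0 hh0 (hK T σ₀ _ hT.le).1 (hK T σ₀ _ hT.le).2 ?_
    rw [← hr2, dotProduct_self_eq_norm_sq, dotProduct_self_eq_norm_sq, WithLp.toLp_ofLp,
      WithLp.toLp_ofLp, hx1, one_pow, mul_one]
    exact pow_lt_pow_left₀ (hw.trans_le (mul_le_of_le_one_right hr0.le hs1)) (norm_nonneg _)
      two_ne_zero
  calc c * (1 / K) ^ (n - 1) * √(h / lam) ^ (n - 1) / (M : ℝ) ^ T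
      = c * r ^ (n - 1) / (M : ℝ) ^ T := by rw [hr, mul_pow]; ring
    _ ≤ (sphereUniform n).real A / (M : ℝ) ^ T := by gcongr
    _ = (datumLaw n M T).real (A ×ˢ {σ₀}) := (datumLaw_real_prod_singleton A σ₀).symm
    _ ≤ (datumLaw n M T).real {δ | ¬ S.Decrease k γ P δ.2 (WithLp.ofLp δ.1.1)} := by
        refine measureReal_mono ?_
        rintro ⟨x, σ⟩ ⟨hx, rfl⟩
        exact hx

end Violation

end SLS

section TracelessSymmetric

variable (ι : Type*) [Fintype ι]

/-- The space of symmetric real matrices of trace zero. Scaling a Lyapunov matrix `P` so that its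
trace is that of `1` places it in `1 + tracelessSymmetricMatrices ι`. -/
def tracelessSymmetricMatrices : Submodule ℝ (Matrix ι ι ℝ) :=
  selfAdjoint.submodule ℝ (Matrix ι ι ℝ) ⊓ LinearMap.ker (traceLinearMap ι ℝ ℝ)

theorem finrank_selfAdjoint_matrix_le :
    Module.finrank ℝ (selfAdjoint.submodule ℝ (Matrix ι ι ℝ)) ≤ (Fintype.card ι + 1).choose 2 := by
  classical
  rw [← Sym2.card, ← Module.finrank_fintype_fun_eq_card ℝ (η := Sym2 ι)]
  let entries : selfAdjoint.submodule ℝ (Matrix ι ι ℝ) →ₗ[ℝ] (Sym2 ι → ℝ) :=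
    { toFun := fun A => Sym2.lift ⟨fun i j => A.1 i j, fun i j => by
        simpa using congrFun₂ (show star A.1 = A.1 from A.2) j i⟩
      map_add' := fun A B => by
        ext z
        induction z with | _ i j => rfl
      map_smul' := fun c A => by
        ext z
        induction z with | _ i j => rfl }
  refine LinearMap.finrank_le_finrank_of_injective (f := entries) fun A B h => ?_
  ext i j
  exact congrFun h s(i, j)

theorem finrank_tracelessSymmetricMatrices_add_one_le [Nonempty ι] :
    Module.finrank ℝ (tracelessSymmetricMatrices ι) + 1 ≤
      Fintype.card ι * (Fintype.card ι + 1) / 2 := by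
  classical
  have hlt : tracelessSymmetricMatrices ι < selfAdjoint.submodule ℝ (Matrix ι ι ℝ) := by
    refine lt_of_le_of_ne inf_le_left fun h => ?_
    have hone : (1 : Matrix ι ι ℝ) ∈ tracelessSymmetricMatrices ι :=
      h ▸ IsSelfAdjoint.one (Matrix ι ι ℝ)
    have htrace : trace (1 : Matrix ι ι ℝ) = 0 := hone.2
    rw [trace_one] at htrace
    exact Fintype.card_ne_zero (α := ι) (by exact_mod_cast htrace)
  calc Module.finrank ℝ (tracelessSymmetricMatrices ι) + 1
      ≤ Module.finrank ℝ (selfAdjoint.submodule ℝ (Matrix ι ι ℝ)) :=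
        Submodule.finrank_lt_finrank_of_lt hlt
    _ ≤ (Fintype.card ι + 1).choose 2 := finrank_selfAdjoint_matrix_le ι
    _ = Fintype.card ι * (Fintype.card ι + 1) / 2 := by
        rw [Nat.choose_two_right, Nat.add_sub_cancel, mul_comm]

variable {ι}

theorem exists_inv_smul_sub_one_mem_tracelessSymmetricMatrices [Nonempty ι] [DecidableEq ι]
    {P : Matrix ι ι ℝ} {lam : ℝ} (hP : (P - 1).PosSemidef) (hPlam : (lam • 1 - P).PosSemidef) :
    ∃ τ ∈ Set.Icc 1 lam, τ⁻¹ • P - 1 ∈ tracelessSymmetricMatrices ι := by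
  have hcard : (0 : ℝ) < Fintype.card ι := by exact_mod_cast Fintype.card_pos
  have htrace : (Fintype.card ι : ℝ) ≤ trace P := by
    simpa [trace_sub, trace_one] using hP.trace_nonneg
  have htrace' : trace P ≤ lam * Fintype.card ι := by
    simpa [trace_sub, trace_smul, trace_one] using hPlam.trace_nonneg
  refine ⟨trace P / Fintype.card ι, ⟨(one_le_div hcard).2 htrace, (div_le_iff₀ hcard).2 htrace'⟩,
    ?_, ?_⟩
  · exact ((posDef_of_sub_one hP).1.smul (IsSelfAdjoint.all _)).sub isHermitian_one
  · have hP0 : trace P ≠ 0 := (hcard.trans_le htrace).ne'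
    rw [SetLike.mem_coe, LinearMap.mem_ker, traceLinearMap_apply, trace_sub, trace_smul, trace_one,
      smul_eq_mul, inv_div, div_mul_cancel₀ _ hP0, sub_self]

end TracelessSymmetric

theorem isClosed_setOf_posSemidef {ι Z : Type*} [Finite ι] [TopologicalSpace Z]
    {f : Z → Matrix ι ι ℝ} (hf : Continuous f) : IsClosed {z | (f z).PosSemidef} := by
  cases nonempty_fintype ι
  simp only [posSemidef_iff_dotProduct_mulVec]
  refine IsClosed.and (isClosed_eq (hf.matrix_conjTranspose) hf) ?_
  simp only [Set.ofPred_forall]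
  exact isClosed_iInter fun w => isClosed_le continuous_const
    (continuous_const.dotProduct (hf.matrix_mulVec continuous_const))

namespace SLS

variable {n p M k T : ℕ} (S : SLS n p M)

section Slice

theorem decrease_smul {γ c : ℝ} (hc : 0 < c) {P : Matrix (Fin k × Fin p) (Fin k × Fin p) ℝ}
    {σ : Fin T → Fin M} {x : Fin n → ℝ} :
    S.Decrease k γ (c • P) σ x ↔ S.Decrease k γ P σ x := by
  rw [decrease_iff, decrease_iff, energy_matrix_smul, energy_matrix_smul, mul_left_comm,
    mul_le_mul_iff_right₀ hc]

variable {E : Type*} [NormedAddCommGroup E] [NormedSpace ℝ E]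
  (L : E →ₗ[ℝ] Matrix (Fin k × Fin p) (Fin k × Fin p) ℝ) {γ lam : ℝ}

/-- The parameters `X` for which the inequality `(*)` holds at the datum `δ` with the Lyapunov
matrix `1 + L X`, which is required to be a multiple `t P` of some `I ⪯ P ⪯ lam I`. -/
def lyapunovSlice (γ lam : ℝ) (δ : Datum n M T) : Set E :=
  {X | ∃ t ∈ Set.Icc (1 / lam) 1, (1 + L X - t • 1).PosSemidef ∧
    ((lam * t) • 1 - (1 + L X)).PosSemidef ∧
      S.Decrease k γ (1 + L X) δ.2 (WithLp.ofLp δ.1.1)}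

variable (γ lam) in
theorem convex_lyapunovSlice (δ : Datum n M T) : Convex ℝ (S.lyapunovSlice L γ lam δ) := by
  rintro X ⟨t, ht, hXlow, hXup, hX⟩ Y ⟨s, hs, hYlow, hYup, hY⟩ a b ha hb hab
  have haffine : 1 + L (a • X + b • Y) = a • (1 + L X) + b • (1 + L Y) := by
    rw [map_add, map_smul, map_smul, smul_add, smul_add, add_add_add_comm, ← add_smul, hab,
      one_smul]
  refine ⟨a * t + b * s, convex_Icc (1 / lam) 1 ht hs ha hb hab, ?_, ?_, ?_⟩
  · rw [haffine]
    convert (hXlow.smul ha).add (hYlow.smul hb) using 1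
    module
  · rw [haffine]
    convert (hXup.smul ha).add (hYup.smul hb) using 1
    module
  · have henergy (l : ℕ) (x : Fin n → ℝ) : S.energy (a • (1 + L X) + b • (1 + L Y)) δ.2 l x =
        a * S.energy (1 + L X) δ.2 l x + b * S.energy (1 + L Y) δ.2 l x := by
      rw [energy_matrix_add, energy_matrix_smul, energy_matrix_smul]
    rw [decrease_iff] at hX hY
    rw [haffine, decrease_iff, henergy, henergy]
    linarith [mul_le_mul_of_nonneg_left hX ha, mul_le_mul_of_nonneg_left hY hb]

variable (γ lam) in
theorem isClosed_lyapunovSlice [FiniteDimensional ℝ E] :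
    IsClosed {q : Datum n M T × E | q.2 ∈ S.lyapunovSlice L γ lam q.1} := by
  have hL : Continuous fun r : Set.Icc (1 / lam) 1 × (Datum n M T × E) => 1 + L r.2.2 :=
    continuous_const.add (L.continuous_of_finiteDimensional.comp (by fun_prop))
  have hF : IsClosed {r : Set.Icc (1 / lam) 1 × (Datum n M T × E) |
      (1 + L r.2.2 - r.1.1 • 1).PosSemidef ∧ ((lam * r.1.1) • 1 - (1 + L r.2.2)).PosSemidef ∧
        S.Decrease k γ (1 + L r.2.2) r.2.1.2 (WithLp.ofLp r.2.1.1.1)} :=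
    (isClosed_setOf_posSemidef (hL.sub (by fun_prop))).and
      ((isClosed_setOf_posSemidef (.sub (by fun_prop) hL)).and
        (S.isClosed_setOf_decrease hL (by fun_prop) γ))
  convert isClosedMap_snd_of_compactSpace _ hF using 1
  ext ⟨δ, X⟩
  constructor
  · rintro ⟨t, ht, h⟩
    exact ⟨(⟨t, ht⟩, δ, X), h, rfl⟩
  · rintro ⟨⟨t, δ', X'⟩, h, heq⟩
    obtain ⟨rfl, rfl⟩ := Prod.mk.inj heq
    exact ⟨t.1, t.2, h⟩

theorem mem_lyapunovSlice {P : Matrix (Fin k × Fin p) (Fin k × Fin p) ℝ} {τ : ℝ} {X : E}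
    {δ : Datum n M T} (hP : (P - 1).PosSemidef) (hPlam : (lam • 1 - P).PosSemidef)
    (hτ : τ ∈ Set.Icc 1 lam) (hX : 1 + L X = τ⁻¹ • P)
    (hdec : S.Decrease k γ P δ.2 (WithLp.ofLp δ.1.1)) : X ∈ S.lyapunovSlice L γ lam δ := by
  have hτ0 : 0 < τ := one_pos.trans_le hτ.1
  refine ⟨τ⁻¹, ⟨one_div lam ▸ inv_anti₀ hτ0 hτ.2, inv_le_one_of_one_le₀ hτ.1⟩, ?_, ?_, ?_⟩
  · rw [hX, ← smul_sub]
    exact hP.smul (inv_pos.2 hτ0).le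
  · rw [hX, mul_comm, mul_smul, ← smul_sub]
    exact hPlam.smul (inv_pos.2 hτ0).le
  · rwa [hX, S.decrease_smul (inv_pos.2 hτ0)]

theorem le_datumLaw_notMem_lyapunovSlice [NeZero n] [NeZero M] (hlam : 1 ≤ lam) {a : ℝ}
    (hviol : ∀ P : Matrix (Fin k × Fin p) (Fin k × Fin p) ℝ, (P - 1).PosSemidef →
      (lam • 1 - P).PosSemidef →
        a ≤ (datumLaw n M T).real {δ | ¬ S.Decrease k γ P δ.2 (WithLp.ofLp δ.1.1)})
    (X : E) : a ≤ (datumLaw n M T).real {δ | X ∉ S.lyapunovSlice L γ lam δ} := by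
  by_cases hX : ∃ t ∈ Set.Icc (1 / lam) 1, (1 + L X - t • 1).PosSemidef ∧
      ((lam * t) • 1 - (1 + L X)).PosSemidef
  · obtain ⟨t, ht, hlow, hup⟩ := hX
    have ht0 : 0 < t := lt_of_lt_of_le (by positivity) ht.1
    have hlow' : (t⁻¹ • (1 + L X) - 1).PosSemidef := by
      convert hlow.smul (inv_pos.2 ht0).le using 1
      rw [smul_sub, inv_smul_smul₀ ht0.ne']
    have hup' : (lam • 1 - t⁻¹ • (1 + L X)).PosSemidef := by
      convert hup.smul (inv_pos.2 ht0).le using 1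
      rw [smul_sub, mul_comm, mul_smul, inv_smul_smul₀ ht0.ne']
    refine (hviol _ hlow' hup').trans (measureReal_mono fun δ hδ hmem => ?_)
    obtain ⟨_, _, _, _, hdec⟩ := hmem
    exact hδ ((S.decrease_smul (inv_pos.2 ht0)).2 hdec)
  · have huniv : {δ : Datum n M T | X ∉ S.lyapunovSlice L γ lam δ} = Set.univ :=
      Set.eq_univ_of_forall fun δ ⟨t, ht, hlow, hup, _⟩ => hX ⟨t, ht, hlow, hup⟩
    rw [huniv, probReal_univ]
    exact (hviol 1 (by simpa using PosSemidef.zero) (posSemidef_smul_one_sub_one hlam)).trans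
      measureReal_le_one

end Slice

section ScenarioBound

variable [NeZero n] [NeZero M] (hk : S.pathwiseIndex ≤ (k : ℕ∞))

include hk

theorem mul_pos_of_pathwiseIndex_le : 0 < k * p := by
  by_contra! h
  have hempty : IsEmpty (Fin k × Fin p) := by
    rw [← Fintype.card_eq_zero_iff]
    simpa using h
  have hone : (fun _ => 1 : Fin n → ℝ) = 0 :=
    S.eq_zero_of_window_eq_zero hk le_rfl (σ := fun _ => 0) (Subsingleton.elim _ _)
  exact one_ne_zero (congrFun hone 0)

theorem sampleLaw_gammaStar_lt_le {N d : ℕ} (hT : k < T) {lam γ e : ℝ} (hlam : 1 ≤ lam)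
    (he : 0 < e) (hd : d = k * p * (k * p + 1) / 2) (hdN : d ≤ N)
    (hviol : ∀ P : Matrix (Fin k × Fin p) (Fin k × Fin p) ℝ, (P - 1).PosSemidef →
      (lam • 1 - P).PosSemidef → 12 * d * e ≤
        (datumLaw n M T).real {δ | ¬ S.Decrease k γ P δ.2 (WithLp.ofLp δ.1.1)}) :
    (sampleLaw n M T N).real {ω | S.gammaStar k T lam ω < γ} ≤
      max (1 - N.choose d * e ^ d) ((1 - e) ^ N) := by
  set V := tracelessSymmetricMatrices (Fin k × Fin p)
  have hcard : Fintype.card (Fin k × Fin p) = k * p := by simp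
  have : Nonempty (Fin k × Fin p) :=
    Fintype.card_pos_iff.1 (hcard ▸ S.mul_pos_of_pathwiseIndex_le hk)
  let φ : EuclideanSpace ℝ (Fin (Module.finrank ℝ V)) ≃ₗ[ℝ] V :=
    LinearEquiv.ofFinrankEq _ _ finrank_euclideanSpace_fin
  let L := V.subtype ∘ₗ φ.toLinearMap
  have hdim : Module.finrank ℝ (EuclideanSpace ℝ (Fin (Module.finrank ℝ V))) + 1 ≤ d := by
    rw [finrank_euclideanSpace_fin, hd, ← hcard]
    exact finrank_tracelessSymmetricMatrices_add_one_le _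
  refine (measureReal_mono fun ω hω => ?_).trans (feasibilityProb_le_max (datumLaw n M T)
    (S.convex_lyapunovSlice L γ lam) (S.isClosed_lyapunovSlice L γ lam) hdim hdN he
    (S.le_datumLaw_notMem_lyapunovSlice L hlam hviol))
  obtain ⟨γ', P, hγ', hγ'0, hP, hPlam, hdec⟩ := (S.gammaStar_lt_iff hk hT hlam ω).1 hω
  obtain ⟨τ, hτ, hmem⟩ := exists_inv_smul_sub_one_mem_tracelessSymmetricMatrices hP hPlam
  have hX : 1 + L (φ.symm ⟨_, hmem⟩) = τ⁻¹ • P := by simp [L]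
  exact ⟨φ.symm ⟨_, hmem⟩, Set.mem_iInter₂.2 fun i _ => S.mem_lyapunovSlice L hP hPlam hτ hX
    (Decrease.mono S hγ'0 hγ'.le (posDef_of_sub_one hP).posSemidef (hdec i))⟩

end ScenarioBound

end SLS

section Submultiplicative

theorem exists_tendsto_of_forall_tendsto_max {u : ℕ → ℝ} (hu : ∀ j, 0 ≤ u j)
    (h : ∀ r : ℝ, 0 < r → ∃ L, Tendsto (fun j => max (u j) r) atTop (𝓝 L)) :
    ∃ L, Tendsto u atTop (𝓝 L) := by
  by_cases hr : ∃ r : ℝ, 0 < r ∧ ∃ L, r < L ∧ Tendsto (fun j => max (u j) r) atTop (𝓝 L)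
  · obtain ⟨r, -, L, hL, hlim⟩ := hr
    refine ⟨L, hlim.congr' ?_⟩
    filter_upwards [hlim.eventually_const_lt hL] with j hj
    exact max_eq_left ((lt_max_iff.1 hj).resolve_right (lt_irrefl _)).le
  · push Not at hr
    refine ⟨0, tendsto_order.2 ⟨fun a ha => Eventually.of_forall fun j => ha.trans_le (hu j),
      fun a ha => ?_⟩⟩
    obtain ⟨L, hL⟩ := h (a / 2) (half_pos ha)
    have hle : L ≤ a / 2 := not_lt.1 fun hlt => hr _ (half_pos ha) L hlt hL
    filter_upwards [hL.eventually_lt_const (hle.trans_lt (half_lt_self ha))] with j hj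
    exact (le_max_left _ _).trans_lt hj

-- Truncating `s j` from below by `r ^ j` keeps it submultiplicative and makes Fekete's lemma
-- applicable to its logarithm.
theorem exists_tendsto_rpow_one_div_of_submultiplicative {s : ℕ → ℝ} (hs : ∀ j, 0 ≤ s j)
    (hmul : ∀ i j, s (i + j) ≤ s i * s j) :
    ∃ L, Tendsto (fun j : ℕ => s j ^ (1 / (j : ℝ))) atTop (𝓝 L) := by
  refine exists_tendsto_of_forall_tendsto_max (fun j => Real.rpow_nonneg (hs j) _) fun r hr => ?_
  have hpos : ∀ j, 0 < max (s j) (r ^ j) := fun j => lt_max_of_lt_right (pow_pos hr j)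
  have hsub : Subadditive fun j => Real.log (max (s j) (r ^ j)) := fun i j => by
    rw [← Real.log_mul (hpos i).ne' (hpos j).ne']
    refine Real.log_le_log (hpos _) (max_le ((hmul i j).trans ?_) ?_)
    · exact mul_le_mul (le_max_left _ _) (le_max_left _ _) (hs j) (hpos i).le
    · rw [pow_add]
      exact mul_le_mul (le_max_right _ _) (le_max_right _ _) (pow_pos hr j).le (hpos i).le
  have hbdd : BddBelow (Set.range fun j : ℕ => Real.log (max (s j) (r ^ j)) / j) := by
    refine ⟨min 0 (Real.log r), ?_⟩
    rintro _ ⟨j, rfl⟩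
    rcases j.eq_zero_or_pos with rfl | hj
    · simp
    · have hj' : (0 : ℝ) < j := by exact_mod_cast hj
      refine (min_le_right _ _).trans ((le_div_iff₀ hj').2 ?_)
      rw [mul_comm, ← Real.log_pow]
      exact Real.log_le_log (pow_pos hr j) (le_max_right _ _)
  refine ⟨Real.exp hsub.lim,
    ((Real.continuous_exp.tendsto _).comp (hsub.tendsto_lim hbdd)).congr' ?_⟩
  filter_upwards [eventually_gt_atTop 0] with j hj
  rw [Function.comp_apply, div_eq_mul_one_div, ← Real.rpow_def_of_pos (hpos j),
    (Real.monotoneOn_rpow_Ici_of_exponent_nonneg (by positivity : (0 : ℝ) ≤ 1 / j)).map_max (hs j)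
      (pow_pos hr j).le, one_div, Real.pow_rpow_inv_natCast hr.le hj.ne']

end Submultiplicative

namespace SLS

variable {n p M : ℕ} (S : SLS n p M)

section JointSpectralRadius

/-- The largest spectral norm of a product of `j` dynamics matrices. The joint spectral radius is
the limit of its `j`-th roots. -/
noncomputable def maxNorm (j : ℕ) : ℝ :=
  ⨆ σ : Fin j → Fin M, ‖Matrix.toEuclideanCLM (𝕜 := ℝ) (S.transition σ j)‖

theorem maxNorm_nonneg (j : ℕ) : 0 ≤ S.maxNorm j := Real.iSup_nonneg fun _ => norm_nonneg _

theorem norm_transition_le_maxNorm {j : ℕ} (σ : Fin j → Fin M) :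
    ‖Matrix.toEuclideanCLM (𝕜 := ℝ) (S.transition σ j)‖ ≤ S.maxNorm j :=
  le_ciSup (f := fun σ : Fin j → Fin M => ‖Matrix.toEuclideanCLM (𝕜 := ℝ) (S.transition σ j)‖)
    (Set.finite_range _).bddAbove σ

theorem transition_append {i j : ℕ} (σ : Fin i → Fin M) (τ : Fin j → Fin M) {t : ℕ} (ht : t ≤ i) :
    S.transition (Fin.append σ τ) t = S.transition σ t := by
  have hσ (a : Fin i) : σ a = Fin.append σ τ ⟨0 + a, by omega⟩ := by
    rw [← Fin.append_left σ τ a]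
    congr 1
    exact Fin.ext (zero_add _).symm
  simpa [transition] using S.transition_add (by omega) hσ ht

theorem transition_append_add {i j : ℕ} (σ : Fin i → Fin M) (τ : Fin j → Fin M) :
    S.transition (Fin.append σ τ) (i + j) = S.transition τ j * S.transition σ i := by
  rw [S.transition_add le_rfl (fun a => (Fin.append_right σ τ a).symm) le_rfl,
    S.transition_append σ τ le_rfl]

variable [NeZero M]

theorem maxNorm_add_le (i j : ℕ) : S.maxNorm (i + j) ≤ S.maxNorm i * S.maxNorm j := by
  refine ciSup_le fun σ => ?_
  rw [← Fin.append_castAdd_natAdd (f := σ), transition_append_add, map_mul,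
    mul_comm (S.maxNorm i)]
  exact (norm_mul_le _ _).trans (mul_le_mul (S.norm_transition_le_maxNorm _)
    (S.norm_transition_le_maxNorm _) (norm_nonneg _) (S.maxNorm_nonneg _))

theorem iSup_norm_transition_rpow {a : ℝ} (ha : 0 ≤ a) (j : ℕ) :
    ⨆ σ : Fin j → Fin M, ‖Matrix.toEuclideanCLM (𝕜 := ℝ) (S.transition σ j)‖ ^ a =
      S.maxNorm j ^ a := by
  obtain ⟨σ, hσ⟩ := exists_eq_ciSup_of_finite
    (f := fun σ : Fin j → Fin M => ‖Matrix.toEuclideanCLM (𝕜 := ℝ) (S.transition σ j)‖)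
  refine le_antisymm (ciSup_le fun σ => ?_) ?_
  · exact Real.rpow_le_rpow (norm_nonneg _) (S.norm_transition_le_maxNorm σ) ha
  · rw [maxNorm, ← hσ]
    exact le_ciSup (f := fun σ : Fin j → Fin M =>
      ‖Matrix.toEuclideanCLM (𝕜 := ℝ) (S.transition σ j)‖ ^ a) (Set.finite_range _).bddAbove σ

theorem tendsto_maxNorm_rpow_jsr :
    Tendsto (fun j : ℕ => S.maxNorm j ^ (1 / (j : ℝ))) atTop (𝓝 S.jsr) := by
  obtain ⟨L, hL⟩ :=
    exists_tendsto_rpow_one_div_of_submultiplicative S.maxNorm_nonneg S.maxNorm_add_le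
  have hjsr : S.jsr = L := by
    rw [jsr]
    simp_rw [S.iSup_norm_transition_rpow (one_div_nonneg.2 (Nat.cast_nonneg _))]
    exact hL.limUnder_eq
  rwa [hjsr]

theorem jsr_le_of_maxNorm_mul_le {m : ℕ} (hm : 0 < m) {C r : ℝ} (hr : 0 ≤ r)
    (h : ∀ j, S.maxNorm (j * m) ≤ C * r ^ (j * m)) : S.jsr ≤ r := by
  have hmul : Tendsto (fun j : ℕ => j * m) atTop atTop := tendsto_id.atTop_mul_const' hm
  have hroot : Tendsto (fun j : ℕ => (max C 1) ^ (1 / (j : ℝ)) * r) atTop (𝓝 r) := by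
    have hC : 0 < max C 1 := lt_max_of_lt_right one_pos
    simpa using ((tendsto_const_nhds (x := max C 1)).rpow tendsto_one_div_atTop_nhds_zero_nat
      (Or.inl hC.ne')).mul_const r
  refine le_of_tendsto_of_tendsto (S.tendsto_maxNorm_rpow_jsr.comp hmul) (hroot.comp hmul) ?_
  filter_upwards [eventually_gt_atTop 0] with j hj
  have hjm : j * m ≠ 0 := (Nat.mul_pos hj hm).ne'
  have hle : S.maxNorm (j * m) ≤ max C 1 * r ^ (j * m) :=
    (h j).trans (mul_le_mul_of_nonneg_right (le_max_left _ _) (pow_nonneg hr _))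
  calc S.maxNorm (j * m) ^ (1 / ((j * m : ℕ) : ℝ))
      ≤ (max C 1 * r ^ (j * m)) ^ (1 / ((j * m : ℕ) : ℝ)) :=
        Real.rpow_le_rpow (S.maxNorm_nonneg _) hle (by positivity)
    _ = max C 1 ^ (1 / ((j * m : ℕ) : ℝ)) * r := by
        rw [Real.mul_rpow (by positivity) (by positivity), one_div,
          Real.pow_rpow_inv_natCast hr hjm]

end JointSpectralRadius

section Growth

variable {k : ℕ} {P : Matrix (Fin k × Fin p) (Fin k × Fin p) ℝ} {γ : ℝ}

theorem energy_add {T T' : ℕ} {σ : Fin T → Fin M} {σ' : Fin T' → Fin M} {l j : ℕ}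
    (hT : l + T' ≤ T) (hσ : ∀ i : Fin T', σ' i = σ ⟨l + i, by omega⟩) (hj : j + k ≤ T')
    (x : Fin n → ℝ) : S.energy P σ (l + j) x = S.energy P σ' j (S.transition σ l *ᵥ x) := by
  rw [energy, energy, S.window_add hT hσ x hj]

theorem RobustFeasible.energy_mul_le {m : ℕ} (h : S.RobustFeasible k (m + k) γ P) {T : ℕ}
    (σ : Fin T → Fin M) (x : Fin n → ℝ) {j : ℕ} (hj : j * m + k ≤ T) :
    S.energy P σ (j * m) x ≤ γ ^ (2 * (j * m)) * S.energy P σ 0 x := by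
  induction j with
  | zero => simp
  | succ j ih =>
    rw [Nat.succ_mul] at hj ⊢
    set σ' : Fin (m + k) → Fin M := fun i => σ ⟨j * m + i, by omega⟩
    have hstep : S.energy P σ (j * m + m) x ≤ γ ^ (2 * m) * S.energy P σ (j * m) x := by
      have hdec := (S.decrease_iff _ _).1 (h.2.2 σ' (S.transition σ (j * m) *ᵥ x))
      rwa [Nat.add_sub_cancel, ← S.energy_add (by omega) (fun _ => rfl) le_rfl,
        ← S.energy_add (by omega) (fun _ => rfl) (by omega), add_zero] at hdec
    calc S.energy P σ (j * m + m) x ≤ γ ^ (2 * m) * S.energy P σ (j * m) x := hstep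
      _ ≤ γ ^ (2 * m) * (γ ^ (2 * (j * m)) * S.energy P σ 0 x) :=
          mul_le_mul_of_nonneg_left (ih (by omega)) (pow_nonneg h.1 _)
      _ = γ ^ (2 * (j * m + m)) * S.energy P σ 0 x := by ring

theorem exists_energy_le_mul_energy_one (P : Matrix (Fin k × Fin p) (Fin k × Fin p) ℝ) :
    ∃ C : ℝ, 0 ≤ C ∧ ∀ (T : ℕ) (σ : Fin T → Fin M) (l : ℕ) (x : Fin n → ℝ),
      S.energy P σ l x ≤ C * S.energy (k := k) 1 σ l x := by
  obtain ⟨K, hK0, hK⟩ := exists_dotProduct_map_le P.mulVecLin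
  refine ⟨1 + K, by linarith, fun T σ l x => ?_⟩
  set w := S.window σ x l k
  have hPw : (P *ᵥ w) ⬝ᵥ (P *ᵥ w) ≤ K * (w ⬝ᵥ w) := hK w
  have hsq : 0 ≤ (w - P *ᵥ w) ⬝ᵥ (w - P *ᵥ w) := dotProduct_self_star_nonneg (w - P *ᵥ w)
  have hw : 0 ≤ (1 + K) * (w ⬝ᵥ w) := mul_nonneg (by linarith) (dotProduct_self_star_nonneg w)
  rw [sub_dotProduct, dotProduct_sub, dotProduct_sub, dotProduct_comm (P *ᵥ w) w] at hsq
  rw [energy, energy, one_mulVec]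
  linarith

variable (hk : S.pathwiseIndex ≤ (k : ℕ∞))

include hk

theorem RobustFeasible.exists_transition_le [NeZero M] {m : ℕ}
    (h : S.RobustFeasible k (m + k) γ P) :
    ∃ C : ℝ, 0 ≤ C ∧ ∀ (j : ℕ) (σ : Fin (j * m) → Fin M) (x : Fin n → ℝ),
      (S.transition σ (j * m) *ᵥ x) ⬝ᵥ (S.transition σ (j * m) *ᵥ x) ≤
        C * γ ^ (2 * (j * m)) * (x ⬝ᵥ x) := by
  obtain ⟨K, hK1, hK⟩ := S.exists_energy_one_bounds hk
  obtain ⟨C, hC0, hC⟩ := S.exists_energy_le_mul_energy_one P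
  have hγ : 0 ≤ γ := h.1
  refine ⟨K * (C * K), by positivity, fun j σ x => ?_⟩
  set τ : Fin k → Fin M := fun _ => 0
  set y := S.transition σ (j * m) *ᵥ x
  have hy : S.energy (k := k) 1 τ 0 y = S.energy (k := k) 1 (Fin.append σ τ) (j * m) x := by
    have hadd := S.energy_add (P := (1 : Matrix (Fin k × Fin p) (Fin k × Fin p) ℝ)) le_rfl
      (fun a => (Fin.append_right σ τ a).symm) (by omega : 0 + k ≤ k) x
    rw [S.transition_append σ τ le_rfl, add_zero] at hadd
    exact hadd.symm
  calc y ⬝ᵥ y ≤ K * S.energy (k := k) 1 (Fin.append σ τ) (j * m) x := hy ▸ (hK k τ y le_rfl).1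
    _ ≤ K * S.energy P (Fin.append σ τ) (j * m) x := by
        gcongr
        exact S.energy_mono h.2.1
    _ ≤ K * (γ ^ (2 * (j * m)) * S.energy P (Fin.append σ τ) 0 x) := by
        gcongr
        exact RobustFeasible.energy_mul_le S h _ x le_rfl
    _ ≤ K * (γ ^ (2 * (j * m)) * (C * (K * (x ⬝ᵥ x)))) := by
        gcongr
        refine (hC _ _ 0 x).trans (mul_le_mul_of_nonneg_left ?_ hC0)
        exact (hK _ _ x (Nat.le_add_left k _)).2
    _ = K * (C * K) * γ ^ (2 * (j * m)) * (x ⬝ᵥ x) := by ring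

theorem RobustFeasible.jsr_le [NeZero M] {T : ℕ} (hT : k < T) (h : S.RobustFeasible k T γ P) :
    S.jsr ≤ γ := by
  obtain ⟨m, rfl⟩ := Nat.exists_eq_add_of_le' hT.le
  obtain ⟨C, hC0, hC⟩ := RobustFeasible.exists_transition_le S hk h
  refine S.jsr_le_of_maxNorm_mul_le (C := √C) (by omega : 0 < m) h.1 fun j => ciSup_le fun σ => ?_
  have hγ := pow_nonneg h.1 (j * m)
  refine ContinuousLinearMap.opNorm_le_bound _ (by positivity) fun x => ?_
  refine le_of_sq_le_sq ?_ (by positivity)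
  have hx := hC j σ x.ofLp
  rw [dotProduct_self_eq_norm_sq, dotProduct_self_eq_norm_sq, WithLp.toLp_ofLp] at hx
  rw [mul_pow, mul_pow, Real.sq_sqrt hC0, ← pow_mul, mul_comm (j * m) 2]
  exact hx

theorem jsr_le_gammaRobust [NeZero M] {T : ℕ} (hT : k < T) : S.jsr ≤ S.gammaRobust k T := by
  refine le_of_forall_gt fun a ha => ?_
  obtain ⟨γ, P, hγ, hP⟩ := S.exists_robustFeasible_of_gammaRobust_lt hk hT ha
  exact (RobustFeasible.jsr_le S hk hT hP).trans_lt hγ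

end Growth

end SLS

namespace SLS

section SuccessEvent

variable {n p M k T : ℕ} (S : SLS n p M)

/-- The constraint that one datum puts on the matrix `P` of the scenario program at the level `γ`.
The matrix is encoded as a function, because matrices carry no canonical norm. -/
def scenarioConstraint (γ lam : ℝ) (δ : Datum n M T) :
    Set (Fin k × Fin p → Fin k × Fin p → ℝ) :=
  {X | (of X - 1).PosSemidef ∧ (lam • 1 - of X).PosSemidef ∧
    S.Decrease k γ (of X) δ.2 (WithLp.ofLp δ.1.1)}

theorem isClosed_scenarioConstraint (γ lam : ℝ) :
    IsClosed {q : Datum n M T × (Fin k × Fin p → Fin k × Fin p → ℝ) |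
      q.2 ∈ S.scenarioConstraint γ lam q.1} := by
  have hP : Continuous fun q : Datum n M T × (Fin k × Fin p → Fin k × Fin p → ℝ) => of q.2 :=
    continuous_snd
  exact (isClosed_setOf_posSemidef (hP.sub continuous_const)).and
    ((isClosed_setOf_posSemidef (continuous_const.sub hP)).and
      (S.isClosed_setOf_decrease hP continuous_fst γ))

section

variable (hk : S.pathwiseIndex ≤ (k : ℕ∞)) (hT : k < T) {lam : ℝ} (hlam : 1 ≤ lam)

include hk hT hlam

theorem gammaStar_lt_iff_exists_rat {N : ℕ} [NeZero N] {a : ℝ} (ω : Fin N → Datum n M T) :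
    S.gammaStar k T lam ω < a ↔ ∃ q : ℚ, ((q : ℝ) < a ∧ 0 ≤ (q : ℝ)) ∧
      ω ∈ feasibleSamples (S.scenarioConstraint (k := k) (T := T) q lam) Finset.univ := by
  simp only [S.gammaStar_lt_iff hk hT hlam, feasibleSamples, Set.mem_ofPred_eq, Set.Nonempty,
    Finset.mem_univ, Set.iInter_true, Set.mem_iInter]
  constructor
  · rintro ⟨γ, P, hγ, hγ0, hP, hPlam, hdec⟩
    obtain ⟨q, hγq, hqa⟩ := exists_rat_btwn hγ
    exact ⟨q, ⟨hqa, hγ0.trans hγq.le⟩, P, fun i =>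
      ⟨hP, hPlam, Decrease.mono S hγ0 hγq.le (posDef_of_sub_one hP).posSemidef (hdec i)⟩⟩
  · rintro ⟨q, ⟨hqa, hq0⟩, X, hX⟩
    exact ⟨q, of X, hqa, hq0, (hX 0).1, (hX 0).2.1, fun i => (hX i).2.2⟩

theorem measurableSet_gammaStar_lt (N : ℕ) (a : ℝ) :
    MeasurableSet {ω : Fin N → Datum n M T | S.gammaStar k T lam ω < a} := by
  rcases N.eq_zero_or_pos with rfl | hN
  · exact Set.subsingleton_of_subsingleton.measurableSet
  have : NeZero N := ⟨hN.ne'⟩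
  simp only [S.gammaStar_lt_iff_exists_rat hk hT hlam, Set.ofPred_exists]
  exact .iUnion fun q => (MeasurableSet.const _).inter
    (measurableSet_feasibleSamples (S.isClosed_scenarioConstraint q lam) _)

theorem gammaStar_comp_le {N N' : ℕ} (f : Fin N → Fin N') (ω : Fin N' → Datum n M T) :
    S.gammaStar k T lam (ω ∘ f) ≤ S.gammaStar k T lam ω := by
  refine le_of_forall_gt fun a ha => ?_
  rw [S.gammaStar_lt_iff hk hT hlam] at ha ⊢
  obtain ⟨γ, P, hγ, hγ0, hP, hPlam, hdec⟩ := ha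
  exact ⟨γ, P, hγ, hγ0, hP, hPlam, fun i => hdec (f i)⟩

theorem ofReal_one_sub_le_sampleLaw_iff [NeZero n] [NeZero M] {β ε : ℝ} (hε : 0 ≤ ε) {N : ℕ} :
    ENNReal.ofReal (1 - β) ≤ sampleLaw n M T N
        {ω | S.gammaRobust k T ≤ (1 + ε) * S.gammaStar k T lam ω} ↔
      (sampleLaw n M T N).real
        {ω | S.gammaStar k T lam ω < S.gammaRobust k T / (1 + ε)} ≤ β := by
  have hcompl : {ω : Fin N → Datum n M T |
      S.gammaRobust k T ≤ (1 + ε) * S.gammaStar k T lam ω} =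
      {ω | S.gammaStar k T lam ω < S.gammaRobust k T / (1 + ε)}ᶜ := by
    ext ω
    simp only [Set.mem_compl_iff, Set.mem_ofPred_eq, not_lt,
      div_le_iff₀' (show 0 < 1 + ε by linarith)]
  rw [ENNReal.ofReal_le_iff_le_toReal (measure_ne_top _ _), ← measureReal_def, hcompl,
    probReal_compl_eq_one_sub (S.measurableSet_gammaStar_lt hk hT hlam N _)]
  exact sub_le_sub_iff_left 1

end

theorem exists_le_of_sampleComplexity_le {lam ε β : ℝ} {N : ℕ}
    (hN : S.sampleComplexity k T lam ε β ≤ (N : ℕ∞)) :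
    ∃ N₀ ≤ N, ENNReal.ofReal (1 - β) ≤ sampleLaw n M T N₀
      {ω | S.gammaRobust k T ≤ (1 + ε) * S.gammaStar k T lam ω} := by
  have hlt : S.sampleComplexity k T lam ε β < ((N + 1 : ℕ) : ℕ∞) :=
    hN.trans_lt (by exact_mod_cast N.lt_succ_self)
  obtain ⟨N₀, h⟩ := iInf_lt_iff.1 hlt
  obtain ⟨hprob, hN₀⟩ := iInf_lt_iff.1 h
  exact ⟨N₀, Nat.lt_succ_iff.1 (by exact_mod_cast hN₀), hprob⟩

theorem sampleLaw_gammaStar_lt_jsr_div_le [NeZero n] [NeZero M]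
    (hk : S.pathwiseIndex ≤ (k : ℕ∞)) (hT : k < T) {lam β ε : ℝ} (hlam : 1 ≤ lam) (hε : 0 ≤ ε)
    {N : ℕ} (hN : S.sampleComplexity k T lam ε β ≤ (N : ℕ∞)) :
    sampleLaw n M T N {ω | S.gammaStar k T lam ω < S.jsr / (1 + ε)} ≤ ENNReal.ofReal β := by
  obtain ⟨N₀, hN₀, hprob⟩ := S.exists_le_of_sampleComplexity_le hN
  have hmeas := S.measurableSet_gammaStar_lt hk hT hlam N₀ (S.gammaRobust k T / (1 + ε))
  have hmp := measurePreserving_pi_comp_of_injective (datumLaw n M T) (Fin.castLE_injective hN₀)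
  calc sampleLaw n M T N {ω | S.gammaStar k T lam ω < S.jsr / (1 + ε)}
      ≤ sampleLaw n M T N ((fun ω => ω ∘ Fin.castLE hN₀) ⁻¹'
          {ω | S.gammaStar k T lam ω < S.gammaRobust k T / (1 + ε)}) := by
        refine measure_mono fun ω hω => ?_
        refine (S.gammaStar_comp_le hk hT hlam _ ω).trans_lt (lt_of_lt_of_le hω ?_)
        gcongr
        exact S.jsr_le_gammaRobust hk hT
    _ = sampleLaw n M T N₀ {ω | S.gammaStar k T lam ω < S.gammaRobust k T / (1 + ε)} :=
        hmp.measure_preimage hmeas.nullMeasurableSet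
    _ ≤ ENNReal.ofReal β := by
        rw [← ofReal_measureReal]
        exact ENNReal.ofReal_le_ofReal ((S.ofReal_one_sub_le_sampleLaw_iff hk hT hlam hε).1 hprob)

end SuccessEvent

end SLS

section PrecisionLevel

theorem one_sub_one_div_pow_mem_Icc {ε : ℝ} (hε : 0 ≤ ε) (q : ℕ) :
    1 - 1 / (1 + ε) ^ q ∈ Set.Icc (0 : ℝ) 1 := by
  have hpow : 1 ≤ (1 + ε) ^ q := one_le_pow₀ (by linarith)
  exact ⟨sub_nonneg.2 ((div_le_one (by linarith)).2 hpow), sub_le_self 1 (by positivity)⟩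

theorem one_sub_one_div_pow_mem_Ioo {ε : ℝ} (hε : 0 < ε) {q : ℕ} (hq : q ≠ 0) :
    1 - 1 / (1 + ε) ^ q ∈ Set.Ioo (0 : ℝ) 1 := by
  have hpow : 1 < (1 + ε) ^ q := one_lt_pow₀ (by linarith) hq
  exact ⟨sub_pos.2 ((div_lt_one (by linarith)).2 hpow), sub_lt_self 1 (by positivity)⟩

theorem half_le_one_sub_one_div_pow {ε : ℝ} (hε : 0 ≤ ε) (hε1 : ε ≤ 1) {q : ℕ} (hq : q ≠ 0) :
    ε / 2 ≤ 1 - 1 / (1 + ε) ^ q := by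
  have hpow : 1 / (1 + ε) ^ q ≤ 1 / (1 + ε) :=
    one_div_le_one_div_of_le (by linarith) (le_self_pow₀ (by linarith) hq)
  have hlin : 1 / (1 + ε) ≤ 1 - ε / 2 := by
    rw [div_le_iff₀ (by linarith)]
    nlinarith
  linarith

theorem rpow_sub_one_div_two {x : ℝ} (hx : 0 ≤ x) {n : ℕ} (hn : 1 ≤ n) :
    x ^ (((n : ℝ) - 1) / 2) = √x ^ (n - 1) := by
  rw [Real.rpow_div_two_eq_sqrt _ hx, ← Nat.cast_pred hn, Real.rpow_natCast]

theorem phiTail_zero (d N : ℕ) : phiTail 0 d N = 1 := by rw [phiTail, regBeta_zero, sub_zero]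

theorem precisionLevel_zero (n M k T : ℕ) (c lam : ℝ) : precisionLevel n M k T c lam 0 = 0 := by
  simp [precisionLevel, regBeta_zero]

section

variable {n M : ℕ} (hn : 2 ≤ n)

include hn

theorem precisionLevel_mem_Icc (hM : 0 < M) {c lam ε : ℝ} (hclam : 1 ≤ c * lam) (hε : 0 ≤ ε)
    (k T : ℕ) : precisionLevel n M k T c lam ε ∈ Set.Icc (0 : ℝ) 1 := by
  have hM' : (1 : ℝ) ≤ M := by exact_mod_cast hM
  have hn' : (2 : ℝ) ≤ n := by exact_mod_cast hn
  have ha : 0 < ((n : ℝ) - 1) / 2 := by linarith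
  have hh := one_sub_one_div_pow_mem_Icc hε (2 * (T - k))
  have hden : 1 ≤ (M : ℝ) ^ T * √((c * lam) ^ (n - 1)) :=
    one_le_mul_of_one_le_of_one_le (one_le_pow₀ hM') (Real.one_le_sqrt.2 (one_le_pow₀ hclam))
  exact ⟨div_nonneg (regBeta_nonneg ha one_half_pos hh) (by linarith),
    (div_le_one (by linarith)).2 ((regBeta_le_one ha one_half_pos hh).trans hden)⟩

theorem exists_mul_rpow_le_precisionLevel (hM : 0 < M) {c lam : ℝ} (hclam : 0 < c * lam)
    {k T : ℕ} (hT : k < T) :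
    ∃ κ : ℝ, 0 < κ ∧ ∀ ε : ℝ, 0 ≤ ε → ε ≤ 1 →
      κ * ε ^ (((n : ℝ) - 1) / 2) ≤ precisionLevel n M k T c lam ε := by
  have hn' : (2 : ℝ) ≤ n := by exact_mod_cast hn
  set a := ((n : ℝ) - 1) / 2
  have ha : 0 < a := by simp only [a]; linarith
  have hB := beta_pos ha one_half_pos
  have : 0 < (M : ℝ) ^ T * √((c * lam) ^ (n - 1)) := by positivity
  refine ⟨(a * beta a (1 / 2))⁻¹ * (1 / 2) ^ a / ((M : ℝ) ^ T * √((c * lam) ^ (n - 1))),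
    by positivity, fun ε hε hε1 => ?_⟩
  set h := 1 - 1 / (1 + ε) ^ (2 * (T - k))
  have hle : ε / 2 ≤ h := half_le_one_sub_one_div_pow hε hε1 (by omega)
  rw [precisionLevel, div_mul_eq_mul_div]
  gcongr
  calc (a * beta a (1 / 2))⁻¹ * (1 / 2) ^ a * ε ^ a
      = (a * beta a (1 / 2))⁻¹ * (ε / 2) ^ a := by
        rw [mul_assoc, ← Real.mul_rpow one_half_pos.le hε, one_div_mul_eq_div]
    _ ≤ (a * beta a (1 / 2))⁻¹ * h ^ a := by gcongr
    _ ≤ regBeta h a (1 / 2) := mul_rpow_le_regBeta ha one_half_pos (by norm_num)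
        (one_sub_one_div_pow_mem_Icc hε _)

theorem exists_precisionLevel_mul_le {q : ℝ} (hq : 0 ≤ q) :
    ∃ c : ℝ, 1 ≤ c ∧ ∀ (k T : ℕ) (lam ε : ℝ), 0 < lam → 0 ≤ ε →
      q * precisionLevel n M k T c lam ε ≤
        √((1 - 1 / (1 + ε) ^ (2 * (T - k))) / lam) ^ (n - 1) / (M : ℝ) ^ T := by
  have hn' : (2 : ℝ) ≤ n := by exact_mod_cast hn
  obtain ⟨b, _, hbeta⟩ := exists_regBeta_le_mul_rpow (a := ((n : ℝ) - 1) / 2) (by linarith)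
    one_half_pos one_half_lt_one.le
  refine ⟨max 1 ((q * b) ^ 2), le_max_left _ _, fun k T lam ε hlam hε => ?_⟩
  set c := max 1 ((q * b) ^ 2)
  set h := 1 - 1 / (1 + ε) ^ (2 * (T - k))
  have hc : 1 ≤ c := le_max_left _ _
  have hh : h ∈ Set.Icc (0 : ℝ) 1 := one_sub_one_div_pow_mem_Icc hε _
  have hqb : q * b ≤ √c ^ (n - 1) := (Real.le_sqrt_of_sq_le (le_max_right _ _)).trans
    (le_self_pow₀ (Real.one_le_sqrt.2 hc) (by omega))
  have hsqrt : √((c * lam) ^ (n - 1)) = √c ^ (n - 1) * √lam ^ (n - 1) := by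
    rw [← mul_pow, ← Real.sqrt_mul (by linarith)]
    simpa using Real.sqrt_prod (Finset.range (n - 1)) fun _ _ => (by positivity : 0 ≤ c * lam)
  have : 0 < √c := Real.sqrt_pos.2 (by linarith)
  calc q * precisionLevel n M k T c lam ε
      = q * regBeta h (((n : ℝ) - 1) / 2) (1 / 2) / (√c ^ (n - 1) * √lam ^ (n - 1)) /
          (M : ℝ) ^ T := by rw [precisionLevel, hsqrt, mul_div_assoc', div_div, mul_comm (_ ^ T)]
    _ ≤ q * (b * √h ^ (n - 1)) / (√c ^ (n - 1) * √lam ^ (n - 1)) / (M : ℝ) ^ T := by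
        gcongr
        rw [← rpow_sub_one_div_two hh.1 (by omega)]
        exact hbeta h hh
    _ ≤ √c ^ (n - 1) * √h ^ (n - 1) / (√c ^ (n - 1) * √lam ^ (n - 1)) / (M : ℝ) ^ T := by
        rw [← mul_assoc]
        gcongr
    _ = √(h / lam) ^ (n - 1) / (M : ℝ) ^ T := by
        rw [Real.sqrt_div hh.1, div_pow, mul_div_mul_left _ _ (by positivity)]

end

end PrecisionLevel

namespace SLS

variable {n p M k : ℕ} [NeZero n] [NeZero M] (S : SLS n p M) (hk : S.pathwiseIndex ≤ (k : ℕ∞))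

include hk

theorem one_le_triangular_of_pathwiseIndex_le : 1 ≤ k * p * (k * p + 1) / 2 := by
  have hkp := S.mul_pos_of_pathwiseIndex_le hk
  rw [Nat.le_div_iff_mul_le two_pos]
  nlinarith

theorem exists_mul_precisionLevel_le_datumLaw (hn : 2 ≤ n) {D : ℝ} (hD : 0 ≤ D) :
    ∃ c : ℝ, 1 ≤ c ∧ ∀ (T : ℕ) (lam ε : ℝ), k < T → 1 ≤ lam → 0 < ε → 0 < S.gammaRobust k T →
      ∀ P : Matrix (Fin k × Fin p) (Fin k × Fin p) ℝ, (P - 1).PosSemidef →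
        (lam • 1 - P).PosSemidef →
        D * precisionLevel n M k T c lam ε ≤ (datumLaw n M T).real
          {δ | ¬ S.Decrease k (S.gammaRobust k T / (1 + ε)) P δ.2 (WithLp.ofLp δ.1.1)} := by
  obtain ⟨v, hv, hviol⟩ := S.exists_le_datumLaw_not_decrease hk
  obtain ⟨c, hc, hlevel⟩ := exists_precisionLevel_mul_le (M := M) hn (div_nonneg hD hv.le)
  refine ⟨c, hc, fun T lam ε hT hlam hε hγ P hP hPlam => ?_⟩
  set h := 1 - 1 / (1 + ε) ^ (2 * (T - k)) with hh
  have hpow : (S.gammaRobust k T / (1 + ε)) ^ (2 * (T - k)) ≤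
      S.gammaRobust k T ^ (2 * (T - k)) * (1 - h) := by
    rw [hh, sub_sub_cancel, mul_one_div, div_pow]
  calc D * precisionLevel n M k T c lam ε
      = v * (D / v * precisionLevel n M k T c lam ε) := by field_simp
    _ ≤ v * (√(h / lam) ^ (n - 1) / (M : ℝ) ^ T) := by
        gcongr
        exact hlevel k T lam ε (by linarith) hε.le
    _ = v * √(h / lam) ^ (n - 1) / (M : ℝ) ^ T := (mul_div_assoc _ _ _).symm
    _ ≤ _ := hviol T lam h _ hT hlam (one_sub_one_div_pow_mem_Ioo hε (by omega)) hγ hpow P hP hPlam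

theorem exists_sampleLaw_gammaStar_lt_le_phiTail (hn : 2 ≤ n) :
    ∃ c : ℝ, 1 ≤ c ∧ ∀ (T : ℕ) (lam ε : ℝ) (N : ℕ), k < T → 1 ≤ lam → 0 ≤ ε →
      k * p * (k * p + 1) / 2 ≤ N →
      (sampleLaw n M T N).real {ω | S.gammaStar k T lam ω < S.gammaRobust k T / (1 + ε)} ≤
        phiTail (precisionLevel n M k T c lam ε) (k * p * (k * p + 1) / 2) N := by
  set d := k * p * (k * p + 1) / 2 with hd
  have hd1 : 1 ≤ d := S.one_le_triangular_of_pathwiseIndex_le hk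
  obtain ⟨c, hc, hlevel⟩ :=
    S.exists_mul_precisionLevel_le_datumLaw hk hn (D := 12 * d) (by positivity)
  refine ⟨c, hc, fun T lam ε N hT hlam hε hN => ?_⟩
  have he := precisionLevel_mem_Icc hn (NeZero.pos M)
    (one_le_mul_of_one_le_of_one_le hc hlam) hε k T
  rcases he.1.eq_or_lt with he0 | he0
  · rw [← he0, phiTail_zero]
    exact measureReal_le_one
  have hε0 : 0 < ε := hε.lt_of_ne fun h => by simp [← h, precisionLevel_zero] at he0
  rcases (S.gammaRobust_nonneg (k := k) (T := T)).eq_or_lt with hγ | hγ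
  · have hempty : {ω : Fin N → Datum n M T |
        S.gammaStar k T lam ω < S.gammaRobust k T / (1 + ε)} = ∅ := by
      simp [← hγ, (S.gammaStar_nonneg _).not_gt]
    rw [hempty, measureReal_empty]
    exact (pow_nonneg (sub_nonneg.2 he.2) N).trans (one_sub_pow_le_phiTail hd1 hN he)
  · exact (S.sampleLaw_gammaStar_lt_le hk hT hlam he0 hd hN (hlevel T lam ε hT hlam hε0 hγ)).trans
      (max_le (one_sub_choose_mul_pow_le_phiTail hd1 hN he) (one_sub_pow_le_phiTail hd1 hN he))

end SLS

section SampleSize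

theorem exists_forall_phiTail_precisionLevel_le {n M k T d : ℕ} (hn : 2 ≤ n) (hM : 0 < M)
    (hT : k < T) (hd : 1 ≤ d) {c lam : ℝ} (hclam : 1 ≤ c * lam) :
    ∃ K : ℝ, 0 < K ∧ ∀ β ε : ℝ, 0 < β → β ≤ 1 → 0 < ε → ε ≤ 1 → ∀ N : ℕ,
      K * (1 / β * (1 / ε) ^ ((n : ℝ) / 2)) ≤ (N : ℝ) →
        d ≤ N ∧ phiTail (precisionLevel n M k T c lam ε) d N ≤ β := by
  obtain ⟨κ, hκ, hlevel⟩ := exists_mul_rpow_le_precisionLevel hn hM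
    (zero_lt_one.trans_le hclam) hT
  have hd0 : (0 : ℝ) < d := by exact_mod_cast hd
  refine ⟨d / κ, by positivity, fun β ε hβ hβ1 hε hε1 N hN => ?_⟩
  set a := ((n : ℝ) - 1) / 2 with ha
  have : 0 < ε ^ a := Real.rpow_pos_of_pos hε _
  have hle := hlevel ε hε.le hε1
  have he := precisionLevel_mem_Icc hn hM hclam hε.le k T
  set e := precisionLevel n M k T c lam ε
  have he0 : 0 < e := lt_of_lt_of_le (by positivity) hle
  have hrpow : 1 / ε ^ a ≤ (1 / ε) ^ ((n : ℝ) / 2) := by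
    rw [one_div, ← Real.inv_rpow hε.le, ← one_div]
    exact Real.rpow_le_rpow_of_exponent_le ((one_le_div hε).2 hε1) (by rw [ha]; linarith)
  have hNe : d / (e * β) ≤ (N : ℝ) := by
    calc d / (e * β) ≤ d / (κ * ε ^ a * β) := by gcongr
      _ = d / κ * (1 / β * (1 / ε ^ a)) := by field_simp
      _ ≤ d / κ * (1 / β * (1 / ε) ^ ((n : ℝ) / 2)) := by gcongr
      _ ≤ N := hN
  have hdN : d ≤ N := by
    have hdiv : (d : ℝ) ≤ d / (e * β) :=
      le_div_self hd0.le (by positivity) (mul_le_one₀ he.2 hβ.le hβ1)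
    exact_mod_cast hdiv.trans hNe
  refine ⟨hdN, (phiTail_le hd hdN he0 he.2).trans ?_⟩
  rw [div_le_iff₀ (by positivity)] at hNe ⊢
  nlinarith [mul_pos he0 hβ]

theorem exists_nPhi_eq_le {d : ℕ} {e β y : ℝ} (hy : 0 ≤ y)
    (h : ∀ N : ℕ, y ≤ (N : ℝ) → d ≤ N ∧ phiTail e d N ≤ β) :
    ∃ m : ℕ, nPhi d e β = (m : ℕ∞) ∧ (m : ℝ) ≤ y + 1 := by
  have hle : nPhi d e β ≤ (⌈y⌉₊ : ℕ∞) := iInf₂_le ⌈y⌉₊ (h ⌈y⌉₊ (Nat.le_ceil y))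
  obtain ⟨m, hm⟩ := ENat.ne_top_iff_exists.1 (ne_top_of_le_ne_top (ENat.natCast_ne_top _) hle)
  rw [← hm] at hle
  have hle' : m ≤ ⌈y⌉₊ := by exact_mod_cast hle
  exact ⟨m, hm.symm, (Nat.cast_le.2 hle').trans (Nat.ceil_lt_add_one hy).le⟩

theorem one_le_one_div_mul_rpow {β ε a : ℝ} (hβ : 0 < β) (hβ1 : β ≤ 1) (hε : 0 < ε) (hε1 : ε ≤ 1)
    (ha : 0 ≤ a) : 1 ≤ 1 / β * (1 / ε) ^ a :=
  one_le_mul_of_one_le_of_one_le ((one_le_div hβ).2 hβ1)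
    (Real.one_le_rpow ((one_le_div hε).2 hε1) ha)

end SampleSize

theorem proposition1_general {n p M : ℕ} (hn : 2 ≤ n) (hM : 0 < M) (S : SLS n p M) (k : ℕ)
    (hk : S.pathwiseIndex ≤ (k : ℕ∞)) :
    (∃ c : ℝ, 1 ≤ c ∧ ∀ (T : ℕ) (lam : ℝ), k < T → 1 ≤ lam →
      (∀ β ε : ℝ, 0 ≤ ε →
        S.sampleComplexity k T lam ε β ≤
          nPhi (k * p * (k * p + 1) / 2) (precisionLevel n M k T c lam ε) β) ∧
      ∃ K : ℝ, 0 < K ∧ ∀ β ε : ℝ, 0 < β → β ≤ 1 → 0 < ε → ε ≤ 1 →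
        (∃ m : ℕ,
          nPhi (k * p * (k * p + 1) / 2) (precisionLevel n M k T c lam ε) β = (m : ℕ∞) ∧
          (m : ℝ) ≤ K * (1 / β * (1 / ε) ^ ((n : ℝ) / 2))) ∧
        ∀ N : ℕ, K * (1 / β * (1 / ε) ^ ((n : ℝ) / 2)) ≤ (N : ℝ) →
          ENNReal.ofReal (1 - β) ≤ sampleLaw n M T N
            {ω | S.gammaRobust k T ≤ (1 + ε) * S.gammaStar k T lam ω}) ∧
    (∀ (T : ℕ) (lam : ℝ), k < T → 1 ≤ lam → ∀ β ε : ℝ, 0 ≤ ε →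
      ∀ N : ℕ, S.sampleComplexity k T lam ε β ≤ (N : ℕ∞) →
        sampleLaw n M T N {ω | S.gammaStar k T lam ω < S.jsr / (1 + ε)} ≤ ENNReal.ofReal β) := by
  have : NeZero n := ⟨by omega⟩
  have : NeZero M := ⟨hM.ne'⟩
  refine ⟨?_, fun T lam hT hlam β ε hε N hN =>
    S.sampleLaw_gammaStar_lt_jsr_div_le hk hT hlam hε hN⟩
  obtain ⟨c, hc, hbound⟩ := S.exists_sampleLaw_gammaStar_lt_le_phiTail hk hn
  refine ⟨c, hc, fun T lam hT hlam => ?_⟩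
  have hsuccess : ∀ β ε : ℝ, 0 ≤ ε → ∀ N : ℕ, k * p * (k * p + 1) / 2 ≤ N ∧
      phiTail (precisionLevel n M k T c lam ε) (k * p * (k * p + 1) / 2) N ≤ β →
      ENNReal.ofReal (1 - β) ≤ sampleLaw n M T N
        {ω | S.gammaRobust k T ≤ (1 + ε) * S.gammaStar k T lam ω} := fun β ε hε N hN =>
    (S.ofReal_one_sub_le_sampleLaw_iff hk hT hlam hε).2
      ((hbound T lam ε N hT hlam hε hN.1).trans hN.2)
  obtain ⟨K, hK, hphi⟩ := exists_forall_phiTail_precisionLevel_le hn hM hT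
    (S.one_le_triangular_of_pathwiseIndex_le hk) (one_le_mul_of_one_le_of_one_le hc hlam)
  refine ⟨fun β ε hε => le_iInf₂ fun N hN => iInf₂_le N (hsuccess β ε hε N hN), K + 1, by linarith,
    fun β ε hβ hβ1 hε hε1 => ?_⟩
  have hy : 1 ≤ 1 / β * (1 / ε) ^ ((n : ℝ) / 2) :=
    one_le_one_div_mul_rpow hβ hβ1 hε hε1 (by positivity)
  obtain ⟨m, hm, hle⟩ := exists_nPhi_eq_le (by positivity) (hphi β ε hβ hβ1 hε hε1)
  exact ⟨⟨m, hm, by linarith⟩, fun N hN =>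
    hsuccess β ε hε.le N (hphi β ε hβ hβ1 hε hε1 N (by linarith))⟩

theorem proposition1 {n p M : ℕ} (hn : 2 ≤ n) (hM : 0 < M) (S : SLS n p M) (k : ℕ)
    (hk : S.pathwiseIndex ≤ (k : ℕ∞)) :
    (∃ c : ℝ, 1 ≤ c ∧ ∀ (T : ℕ) (lam : ℝ), k < T → 1 ≤ lam →
      (∀ σ : Fin T → Fin M, ¬ S.Degenerate k σ) →
        (∀ β ε : ℝ, 0 < β → β < 1 → 0 ≤ ε →
          S.sampleComplexity k T lam ε β ≤
            nPhi (k * p * (k * p + 1) / 2) (precisionLevel n M k T c lam ε) β) ∧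
        ∃ K : ℝ, 0 < K ∧
          (∀ β ε : ℝ, 0 < β → β < 1 → 0 < ε → ε ≤ 1 →
            ∃ m : ℕ,
              nPhi (k * p * (k * p + 1) / 2) (precisionLevel n M k T c lam ε) β = (m : ℕ∞) ∧
              (m : ℝ) ≤ K * (1 / β * (1 / ε) ^ ((n : ℝ) / 2))) ∧
          (∀ β ε : ℝ, 0 < β → β < 1 → 0 < ε → ε ≤ 1 →
            ∀ N : ℕ, K * (1 / β * (1 / ε) ^ ((n : ℝ) / 2)) ≤ (N : ℝ) →
              ENNReal.ofReal (1 - β) ≤ sampleLaw n M T N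
                {ω | S.gammaRobust k T ≤ (1 + ε) * S.gammaStar k T lam ω})) ∧
    (∀ (T : ℕ) (lam : ℝ), k < T → 1 ≤ lam →
      (∀ σ : Fin T → Fin M, ¬ S.Degenerate k σ) → 1 < S.jsr →
        ∀ β ε : ℝ, 0 < β → β < 1 → 0 ≤ ε →
          ∀ N : ℕ, S.sampleComplexity k T lam ε β ≤ (N : ℕ∞) →
            sampleLaw n M T N {ω | S.gammaStar k T lam ω < 1 / (1 + ε)} ≤
              ENNReal.ofReal β) := by
  obtain ⟨⟨c, hc, hi⟩, hii⟩ := proposition1_general hn hM S k hk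
  refine ⟨⟨c, hc, fun T lam hT hlam _ => ?_⟩, fun T lam hT hlam _ hjsr β ε _ _ hε N hN => ?_⟩
  · obtain ⟨hcomplexity, K, hK, hrate⟩ := hi T lam hT hlam
    exact ⟨fun β ε _ _ => hcomplexity β ε, K, hK,
      fun β ε hβ hβ1 hε hε1 => (hrate β ε hβ hβ1.le hε hε1).1,
      fun β ε hβ hβ1 hε hε1 => (hrate β ε hβ hβ1.le hε hε1).2⟩
  · have hlevel : 1 / (1 + ε) ≤ S.jsr / (1 + ε) := by gcongr
    exact (measure_mono fun _ h => lt_of_lt_of_le h hlevel).trans (hii T lam hT hlam β ε hε N hN)
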